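/- Let $(X_i)_{i\ge 1}$ be a sequence of random vectors in $\mathbb R^d$, $d\ge 1$, on a probability space $(\Omega,\mathcal A,\mathbb P)$. Let $F$ be the distribution function of $X_1$ (inequalities between vectors are componentwise), with margins $F^{[1]},\dots,F^{[d]}$. Let $F_{a:b}(x)=\frac1{b-a+1}\sum_{i=a}^b \mathbf 1(X_i\le x)$ (which is $0$ if $b<a$), with margins $F_{a:b}^{[\ell]}$. For a univariate distribution function $H$ put $H^{-1}(y)=\inf\{x\in\mathbb R: H(x)\ge y\}$. Let $p\ge1$, fix $\pi_1,\dots,\pi_p\in(0,1)^d$, and put $$x_i=\big(F^{[1],-1}(\pi_i^{[1]}),\dots,F^{[d],-1}(\pi_i^{[d]})\big),\qquad \mathcal X_{i,m}=\big(F_{1:m}^{[1],-1}(\pi_i^{[1]}),\dots,F_{1:m}^{[d],-1}(\pi_i^{[d]})\big),$$ $\mathcal P=(x_1,\dots,x_p)$ and $\mathcal P_m=(\mathcal X_{1,m},\dots,\mathcal X_{p,m})$. For a vector of points $\mathcal Q=(z_1,\dots,z_p)$, which may be random and may depend on $m$, let $Y_i^{\mathcal Q}=(\mathbf 1(X_i\le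 z_1),\dots,\mathbf 1(X_i\le z_p))$ and $F_{a:b}^{\mathcal Q}=(F_{a:b}(z_1),\dots,F_{a:b}(z_p))$. For $\mathcal Q\in\{\mathcal P,\mathcal P_m\}$ let $\Sigma_m^{\mathcal Q}$ be a $p\times p$ matrix-valued estimator, that is, a measurable function of $Y_1^{\mathcal Q},\dots,Y_m^{\mathcal Q}$, and let $$D_m^{\mathcal Q}(k)=\max_{m\le j<k}\frac{j(k-j)}{m^{3/2}}\,\big\|F_{1:j}^{\mathcal Q}-F_{j+1:k}^{\mathcal Q}\big\|_{(\Sigma_m^{\mathcal Q})^{-1}},\qquad k\ge m+1,$$ where $\|y\|_M=\sqrt{(y^\top M y)/p}$ (with the harmless convention that the inverse of a singular matrix and the square root of a negative number are $0$). All limits, $o_{\mathbb P}$ and $O_{\mathbb P}$ are as $m\to\infty$; suprema may be infinite. Assume the following. (a) Approximation. The series $(Y_i^{\mathcal P})_{i\ge1}$ is stationary, and its long-run covariance matrix $\Sigma^{\mathcal P}=\mathrm{Cov}(Y_1^{\mathcal P},Y_1^{\mathcal P})+\sum_{i\ge2}\{\mathrm{Cov}(Y_1^{\mathcal P},Y_i^{\mathcal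 P})+\mathrm{Cov}(Y_i^{\mathcal P},Y_1^{\mathcal P})\}$ exists and is positive-definite. On some probability space there exist a sequence with the same law as $(Y_i^{\mathcal P})_{i\ge1}$ (denoted in the same way) and, for each $m$, two independent $p$-dimensional standard Brownian motions $W_{1,m},W_{2,m}$ such that, for some $0<\xi<\frac12$, $$\sup_{k>m}\frac1{(k-m)^{\xi}}\Big\|\sum_{i=m+1}^k\{Y_i^{\mathcal P}-\mathbb E(Y_1^{\mathcal P})\}-(\Sigma^{\mathcal P})^{1/2}W_{1,m}(k-m)\Big\|_2=O_{\mathbb P}(1),$$ $$\frac1{m^{\xi}}\Big\|\sum_{i=1}^m\{Y_i^{\mathcal P}-\mathbb E(Y_1^{\mathcal P})\}-(\Sigma^{\mathcal P})^{1/2}W_{2,m}(m)\Big\|_2=O_{\mathbb P}(1).$$ (b) Points. For every $i\in\{1,\dots,p\}$, $$\sup_{k>m}k^{-1/2}\max_{1\le j\le k} j\,\big|F_{1:j}(\mathcal X_{i,m})-F(\mathcal X_{i,m})-F_{1:j}(x_i)+F(x_i)\big|=o_{\mathbb P}(1).$$ (c) Consistency. $\Sigma_m^{\mathcal P}\to\Sigma^{\mathcal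 P}$ and $\Sigma_m^{\mathcal P_m}\to\Sigma^{\mathcal P}$ in probability. Then, for every $\eta>0$, $$\sup_{k>m}(m/k)^{\frac32+\eta}\,\big|D_m^{\mathcal P_m}(k)-D_m^{\mathcal P}(k)\big|=o_{\mathbb P}(1),$$ and, consequently, $\sup_{k>m}(m/k)^{\frac32+\eta}D_m^{\mathcal P_m}(k)$ converges in distribution to $$\mathcal L_{p,\eta}=\sup_{1\le s\le t<\infty}t^{-\frac32-\eta}\,\|tW(s)-sW(t)\|_{I_p},$$ where $W$ is a $p$-dimensional standard Brownian motion, $I_p$ is the $p\times p$ identity matrix, and $\mathcal L_{p,\eta}$ is almost surely finite. -/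

import Mathlib

open MeasureTheory ProbabilityTheory Filter Topology
open scoped ENNReal NNReal Matrix

universe u v w

/-- Empirical distribution function at `z` of the observations with (zero-based) indices in
`{a, …, b - 1}`; for observations numbered from `1` this is `F_{a+1:b}(z)`. It is `0` if the block
is empty. It is used both for vectors (componentwise order) and for real numbers (margins). -/
noncomputable def empDF {α : Type*} [Preorder α] (x : ℕ → α) (a b : ℕ) (z : α) : ℝ :=
  (∑ i ∈ Finset.Ico a b, (Set.Iic z).indicator 1 (x i)) / ((b : ℝ) - (a : ℝ))

/-- Distribution function `z ↦ P(Z ≤ z)` of a random element of an ordered space. -/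
noncomputable def popDF {Ω : Type*} [MeasurableSpace Ω] {α : Type*} [Preorder α]
    (μ : Measure Ω) (Z : Ω → α) (z : α) : ℝ :=
  μ.real {ω | Z ω ≤ z}

/-- Quantile function (generalized inverse) of a univariate distribution function. -/
noncomputable def quantile (H : ℝ → ℝ) (y : ℝ) : ℝ :=
  sInf {x : ℝ | y ≤ H x}

/-- The points whose coordinates are the population quantiles of the margins of `Z`, of orders
given by the vectors of probabilities `π 1, …, π p`. -/
noncomputable def truePoints {Ω : Type*} [MeasurableSpace Ω] {d p : ℕ} (μ : Measure Ω)
    (Z : Ω → Fin d → ℝ) (π : Fin p → Fin d → ℝ) : Fin p → Fin d → ℝ :=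
  fun i l => quantile (popDF μ (fun ω => Z ω l)) (π i l)

/-- The points whose coordinates are the empirical marginal quantiles of the first `m`
observations, of orders given by the vectors of probabilities `π 1, …, π p`. -/
noncomputable def dataPoints {d p : ℕ} (x : ℕ → Fin d → ℝ) (m : ℕ)
    (π : Fin p → Fin d → ℝ) : Fin p → Fin d → ℝ :=
  fun i l => quantile (empDF (fun n => x n l) 0 m) (π i l)

/-- `(1(z ≤ x₁), …, 1(z ≤ x_p))` for `P = (x₁, …, x_p)`. -/
noncomputable def indVec {d p : ℕ} (P : Fin p → Fin d → ℝ) (z : Fin d → ℝ) : Fin p → ℝ :=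
  fun i => (Set.Iic (P i)).indicator 1 z

/-- The weighted norm `‖y‖_M = √((yᵀ M y) / p)`. -/
noncomputable def wnorm {p : ℕ} (M : Matrix (Fin p) (Fin p) ℝ) (y : Fin p → ℝ) : ℝ :=
  √((y ⬝ᵥ (M *ᵥ y)) / (p : ℝ))

/-- The detector `D_m(k)` computed along the data path `x` at the points `P`:
`max_{m ≤ j < k} j (k - j) m^{-3/2} ‖F_{1:j} - F_{j+1:k}‖_{S⁻¹}`, where
`S = est m (Y₁, …, Y_m)` is the value of a covariance estimator on the indicator vectors of the
learning sample. -/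
noncomputable def detector {d p : ℕ}
    (est : (m : ℕ) → (Fin m → Fin p → ℝ) → Matrix (Fin p) (Fin p) ℝ)
    (x : ℕ → Fin d → ℝ) (P : Fin p → Fin d → ℝ) (m k : ℕ) : ℝ :=
  ⨆ j : Finset.Ico m k,
    ((j : ℕ) : ℝ) * ((k : ℝ) - ((j : ℕ) : ℝ)) / (m : ℝ) ^ (3 / 2 : ℝ) *
      wnorm (est m (fun i : Fin m => indVec P (x i)))⁻¹
        (fun i => empDF x 0 j (P i) - empDF x j k (P i))

/-- `Z m = o_P(1)` as `m → ∞`, for nonnegative, possibly infinite, random quantities. -/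
def IsLittleOP {Ω : Type*} [MeasurableSpace Ω] (μ : Measure Ω) (Z : ℕ → Ω → ℝ≥0∞) : Prop :=
  ∀ ε : ℝ≥0∞, 0 < ε → Tendsto (fun m => μ {ω | ε ≤ Z m ω}) atTop (𝓝 0)

/-- `Z m = O_P(1)` as `m → ∞`, for nonnegative, possibly infinite, random quantities. -/
def IsBigOP {Ω : Type*} [MeasurableSpace Ω] (μ : Measure Ω) (Z : ℕ → Ω → ℝ≥0∞) : Prop :=
  ∀ ε : ℝ≥0∞, 0 < ε → ∃ M : ℝ≥0, ∀ᶠ m in atTop, μ {ω | (M : ℝ≥0∞) < Z m ω} ≤ ε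

/-- (Strict) stationarity of a time series. -/
def IsStationarySeries {Ω : Type*} [MeasurableSpace Ω] {p : ℕ} (μ : Measure Ω)
    (Y : ℕ → Ω → Fin p → ℝ) : Prop :=
  ∀ h : ℕ, IdentDistrib (fun ω i => Y (i + h) ω) (fun ω i => Y i ω) μ μ

/-- The series that defines the long-run covariance matrix of `Y` converges, with sum `S`. -/
def IsLongRunCov {Ω : Type*} [MeasurableSpace Ω] {p : ℕ} (μ : Measure Ω)
    (Y : ℕ → Ω → Fin p → ℝ) (S : Matrix (Fin p) (Fin p) ℝ) : Prop :=
  ∀ a b : Fin p, Tendsto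
    (fun n : ℕ => covariance (fun ω => Y 0 ω a) (fun ω => Y 0 ω b) μ +
      ∑ i ∈ Finset.range n,
        (covariance (fun ω => Y 0 ω a) (fun ω => Y (i + 1) ω b) μ +
          covariance (fun ω => Y (i + 1) ω a) (fun ω => Y 0 ω b) μ))
    atTop (𝓝 (S a b))

/-- `W` is a `p`-dimensional standard Brownian motion. -/
structure IsStdBrownian {Ω : Type*} [MeasurableSpace Ω] {p : ℕ}
    (W : ℝ≥0 → Ω → Fin p → ℝ) (μ : Measure Ω) : Prop where
  coord : ∀ i, IsBrownianReal (fun t ω => W t ω i) μ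
  indep : iIndepFun (fun (i : Fin p) (ω : Ω) (t : ℝ≥0) => W t ω i) μ

open scoped MatrixOrder in
/-- The square root of a positive-semidefinite matrix. -/
noncomputable def matSqrt {p : ℕ} (S : Matrix (Fin p) (Fin p) ℝ) : Matrix (Fin p) (Fin p) ℝ :=
  CFC.sqrt S

/-- Euclidean norm of the approximation error over the block of (zero-based) indices
`{a, …, b - 1}`: `‖∑_{a ≤ i < b} (Y_i - E Y) - S^{1/2} w‖₂`. -/
noncomputable def approxError {Ω : Type*} [MeasurableSpace Ω] {p : ℕ} (μ : Measure Ω)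
    (Y : ℕ → Ω → Fin p → ℝ) (S : Matrix (Fin p) (Fin p) ℝ) (a b : ℕ)
    (w : Fin p → ℝ) (ω : Ω) : ℝ :=
  ‖WithLp.toLp 2 ((∑ i ∈ Finset.Ico a b, (Y i ω - fun l => ∫ ω', Y 0 ω' l ∂μ))
      - matSqrt S *ᵥ w)‖

/-- The approximation condition, for a time series `Y` with long-run covariance matrix `S`:
`Y` is stationary, its long-run covariance matrix exists, equals `S` and is positive-definite,
and a copy `Y'` of `Y` (same law as a process) can be defined on some probability space together
with, for each `m`, two independent `p`-dimensional standard Brownian motions that approximate its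
partial sums after and up to time `m`. -/
def ApproximationCond {Ω : Type u} [MeasurableSpace Ω] {p : ℕ} (μ : Measure Ω)
    (Y : ℕ → Ω → Fin p → ℝ) (S : Matrix (Fin p) (Fin p) ℝ) : Prop :=
  IsStationarySeries μ Y ∧ IsLongRunCov μ Y S ∧ S.PosDef ∧
  ∃ (Ω' : Type v) (_ : MeasurableSpace Ω') (μ' : Measure Ω') (_ : IsProbabilityMeasure μ')
    (Y' : ℕ → Ω' → Fin p → ℝ) (W₁ W₂ : ℕ → ℝ≥0 → Ω' → Fin p → ℝ) (ξ : ℝ),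
    IdentDistrib (fun ω i => Y' i ω) (fun ω i => Y i ω) μ' μ ∧
    (∀ m, IsStdBrownian (W₁ m) μ') ∧ (∀ m, IsStdBrownian (W₂ m) μ') ∧
    (∀ m, IndepFun (fun ω t => W₁ m t ω) (fun ω t => W₂ m t ω) μ') ∧
    0 < ξ ∧ ξ < 1 / 2 ∧
    IsBigOP μ' (fun m ω => ⨆ (k : ℕ) (_ : m < k), ENNReal.ofReal
      (1 / ((k : ℝ) - (m : ℝ)) ^ ξ *
        approxError μ' Y' S m k (W₁ m ((k - m : ℕ) : ℝ≥0) ω) ω)) ∧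
    IsBigOP μ' (fun m ω => ENNReal.ofReal
      (1 / (m : ℝ) ^ ξ * approxError μ' Y' S 0 m (W₂ m (m : ℝ≥0) ω) ω))

/-- The condition on the data-driven points: for each of the `p` points,
`sup_{k > m} k^{-1/2} max_{1 ≤ j ≤ k} j |F_{1:j}(𝒳) - F(𝒳) - F_{1:j}(x) + F(x)| = o_P(1)`, where
`𝒳` is the vector of empirical marginal quantiles of the learning sample and `x` is the vector of
population marginal quantiles. -/
def PointsCond {Ω : Type*} [MeasurableSpace Ω] {d p : ℕ} (μ : Measure Ω)
    (X : ℕ → Ω → Fin d → ℝ) (π : Fin p → Fin d → ℝ) : Prop :=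
  ∀ i : Fin p, IsLittleOP μ (fun m ω =>
    ⨆ (k : ℕ) (_ : m < k) (j : ℕ) (_ : 1 ≤ j) (_ : j ≤ k), ENNReal.ofReal
      ((k : ℝ) ^ (-(1 / 2) : ℝ) * ((j : ℝ) *
        |empDF (fun n => X n ω) 0 j (dataPoints (fun n => X n ω) m π i)
          - popDF μ (X 0) (dataPoints (fun n => X n ω) m π i)
          - empDF (fun n => X n ω) 0 j (truePoints μ (X 0) π i)
          + popDF μ (X 0) (truePoints μ (X 0) π i)|)))

/-- Convergence in probability of the covariance estimators, evaluated on the indicator vectors of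
the learning sample at the (possibly random) points `P m`, to the matrix `S`. -/
def IsConsistent {Ω : Type*} [MeasurableSpace Ω] {d p : ℕ} (μ : Measure Ω)
    (est : (m : ℕ) → (Fin m → Fin p → ℝ) → Matrix (Fin p) (Fin p) ℝ)
    (X : ℕ → Ω → Fin d → ℝ) (P : ℕ → Ω → Fin p → Fin d → ℝ)
    (S : Matrix (Fin p) (Fin p) ℝ) : Prop :=
  ∀ a b : Fin p, TendstoInMeasure μ
    (fun m ω => est m (fun i : Fin m => indVec (P m ω) (X i ω)) a b) atTop (fun _ => S a b)

/-- The functional `sup_{1 ≤ s ≤ t < ∞} t^{-3/2-η} ‖t w(s) - s w(t)‖_{I_p}` of a path `w`. -/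
noncomputable def limitSup {p : ℕ} (η : ℝ) (w : ℝ≥0 → Fin p → ℝ) : ℝ≥0∞ :=
  ⨆ (s : ℝ≥0) (t : ℝ≥0) (_ : 1 ≤ s) (_ : s ≤ t), ENNReal.ofReal
    ((t : ℝ) ^ (-(3 / 2) - η : ℝ) * wnorm 1 ((t : ℝ) • w s - (s : ℝ) • w t))

/-! Write S_n for the partial sums of the indicator vectors and Σ for the long-run covariance
matrix. Since j (k - j) (F_{1:j} - F_{j+1:k}) = k S_j - j S_k, the weighted detector is a maximum
over j of norms of `cusum`. This statistic is linear in the path and vanishes on every drift n ↦ n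
c, so S_n may be centred by n c for any c free of n, even a random one. Centring by n (F(𝒳) - F(x))
turns the change of points into the quantity controlled by `PointsCond`
(`isLittleOP_cusum_dataPoints`). Centring by n E Y_1 lets the approximation condition replace S_n by
Σ^{1/2} U(n), where U follows W₂ up to time m and then adds W₁; the error is of order n^ξ with ξ <
1/2, hence negligible (`isLittleOP_cusum_approx`).

The suprema run over unboundedly many k, so replacing the estimated matrices by Σ also needs
tightness. Kolmogorov's inequality on dyadic blocks bounds sup_{j ≥ m} (m/j)^η j^{-1/2} |B(j)| in
probability, uniformly in m (`IsPreBrownianReal.measure_growth_le`); this uses η > 0. On bounded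
sets of vectors the norm is uniformly continuous at a nonsingular matrix, which gives
`isLittleOP_wnorm_sub`. The norm of Σ^{-1} then cancels Σ^{1/2}.

The process U is again Brownian, so at integer times it has the law of n ↦ √m W(n/m) for one fixed
W. For the latter, the statistic is the limiting functional restricted to the grid s = j/m, t = k/m;
its supremum tends almost surely to `limitSup` by path continuity. Equality in law and Slutsky's
lemma in [0, ∞] transfer this limit to the detector, and the growth bound shows that the limit is
finite. -/

/-! ### Calculus of o_P(1) and O_P(1) in [0, ∞]. -/

section StochasticOrder

variable {Ω : Type*} [MeasurableSpace Ω] {μ : Measure Ω}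

lemma IsLittleOP.mono {Z Z' : ℕ → Ω → ℝ≥0∞} (h : IsLittleOP μ Z')
    (hle : ∀ᶠ m in atTop, ∀ᵐ ω ∂μ, Z m ω ≤ Z' m ω) : IsLittleOP μ Z := by
  intro ε hε
  refine tendsto_of_tendsto_of_tendsto_of_le_of_le' tendsto_const_nhds (h ε hε)
    (Eventually.of_forall fun _ => zero_le) ?_
  filter_upwards [hle] with m hm
  refine measure_mono_ae ?_
  filter_upwards [hm] with ω hω h1
  exact le_trans (show ε ≤ Z m ω from h1) hω

lemma IsLittleOP.add {Z Z' : ℕ → Ω → ℝ≥0∞} (h : IsLittleOP μ Z) (h' : IsLittleOP μ Z') :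
    IsLittleOP μ (fun m ω => Z m ω + Z' m ω) := by
  intro ε hε
  have h2 : 0 < ε / 2 := ENNReal.div_pos hε.ne' (by simp)
  have := (h _ h2).add (h' _ h2)
  rw [add_zero] at this
  refine tendsto_of_tendsto_of_tendsto_of_le_of_le tendsto_const_nhds this
    (fun _ => zero_le) fun m => ?_
  refine le_trans (measure_mono ?_) (measure_union_le _ _)
  intro ω (hω : ε ≤ Z m ω + Z' m ω)
  by_contra hcon
  simp only [Set.mem_union, Set.mem_ofPred_eq, not_or, not_le] at hcon
  have := ENNReal.add_lt_add hcon.1 hcon.2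
  rw [ENNReal.add_halves] at this
  exact absurd hω (not_le.2 this)

lemma isLittleOP_zero : IsLittleOP μ (fun _ _ => 0) := by
  intro ε hε
  simp [hε.ne']

lemma IsLittleOP.sum {ι : Type*} (s : Finset ι) {Z : ι → ℕ → Ω → ℝ≥0∞}
    (h : ∀ i ∈ s, IsLittleOP μ (Z i)) : IsLittleOP μ (fun m ω => ∑ i ∈ s, Z i m ω) := by
  classical
  induction s using Finset.induction_on with
  | empty => simpa using isLittleOP_zero
  | insert a s ha ih =>
    simp_rw [Finset.sum_insert ha]
    exact (h a (Finset.mem_insert_self a s)).add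
      (ih fun i hi => h i (Finset.mem_insert_of_mem hi))

lemma IsBigOP.mono {Z Z' : ℕ → Ω → ℝ≥0∞} (h : IsBigOP μ Z')
    (hle : ∀ᶠ m in atTop, ∀ᵐ ω ∂μ, Z m ω ≤ Z' m ω) : IsBigOP μ Z := by
  intro ε hε
  obtain ⟨M, hM⟩ := h ε hε
  refine ⟨M, ?_⟩
  filter_upwards [hM, hle] with m hm hm'
  refine le_trans (measure_mono_ae ?_) hm
  filter_upwards [hm'] with ω hω h1
  exact lt_of_lt_of_le (show (M : ℝ≥0∞) < Z m ω from h1) hω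

lemma IsBigOP.add_isLittleOP {Z Z' : ℕ → Ω → ℝ≥0∞} (h : IsBigOP μ Z) (h' : IsLittleOP μ Z') :
    IsBigOP μ (fun m ω => Z m ω + Z' m ω) := by
  intro ε hε
  have h2 : 0 < ε / 2 := ENNReal.div_pos hε.ne' (by simp)
  obtain ⟨M, hM⟩ := h _ h2
  refine ⟨M + 1, ?_⟩
  filter_upwards [hM, (h' 1 one_pos).eventually (gt_mem_nhds h2)] with m hm hm'
  refine (measure_mono ?_).trans <| (measure_union_le {ω | (M : ℝ≥0∞) < Z m ω}
    {ω | 1 ≤ Z' m ω}).trans <| (add_le_add hm hm'.le).trans (ENNReal.add_halves ε).le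
  intro ω (hω : ((M + 1 : ℝ≥0) : ℝ≥0∞) < Z m ω + Z' m ω)
  by_contra hcon
  simp only [Set.mem_union, Set.mem_ofPred_eq, not_or, not_le, not_lt] at hcon
  have := add_le_add hcon.1 hcon.2.le
  push_cast at hω
  exact absurd hω (not_lt.2 this)

lemma IsBigOP.const_mul {Z : ℕ → Ω → ℝ≥0∞} (h : IsBigOP μ Z) (c : ℝ≥0) :
    IsBigOP μ (fun m ω => c * Z m ω) := by
  intro ε hε
  obtain ⟨M, hM⟩ := h ε hε
  refine ⟨c * M, ?_⟩
  filter_upwards [hM] with m hm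
  refine le_trans (measure_mono ?_) hm
  intro ω (hω : ((c * M : ℝ≥0) : ℝ≥0∞) < c * Z m ω)
  by_contra hcon
  simp only [Set.mem_ofPred_eq, not_lt] at hcon
  refine absurd hω (not_lt.2 ?_)
  push_cast
  gcongr

lemma IsLittleOP.const_mul {Z : ℕ → Ω → ℝ≥0∞} (h : IsLittleOP μ Z) (n : ℕ) :
    IsLittleOP μ (fun m ω => n * Z m ω) := by
  simpa using IsLittleOP.sum (Finset.range n) (Z := fun _ => Z) fun _ _ => h

lemma IsBigOP.of_identDistrib {Ω' : Type*} [MeasurableSpace Ω'] {μ' : Measure Ω'}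
    {Z : ℕ → Ω → ℝ≥0∞} {Z' : ℕ → Ω' → ℝ≥0∞} (h : IsBigOP μ Z)
    (hd : ∀ m, IdentDistrib (Z m) (Z' m) μ μ') : IsBigOP μ' Z' := by
  intro ε hε
  obtain ⟨M, hM⟩ := h ε hε
  refine ⟨M, ?_⟩
  filter_upwards [hM] with m hm
  exact ((hd m).measure_mem_eq (s := Set.Ioi (M : ℝ≥0∞)) measurableSet_Ioi) ▸ hm

end StochasticOrder

/-! ### Convergence in distribution in [0, ∞]. -/

section Distribution

variable {Ω Ω' Ω₀ : Type*} [MeasurableSpace Ω] [MeasurableSpace Ω'] [MeasurableSpace Ω₀]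
  {μ : Measure Ω} [IsProbabilityMeasure μ] {μ' : Measure Ω'} [IsProbabilityMeasure μ']
  {Q : Measure Ω₀} [IsProbabilityMeasure Q]

lemma MeasureTheory.TendstoInDistribution.of_identDistrib {X : ℕ → Ω → ℝ≥0∞} {X' : ℕ → Ω' → ℝ≥0∞}
    {Z : Ω₀ → ℝ≥0∞}
    (h : TendstoInDistribution X atTop Z (fun _ => μ) Q)
    (hX' : ∀ m, AEMeasurable (X' m) μ')
    (hd : ∀ᶠ m in atTop, IdentDistrib (X m) (X' m) μ μ') :
    TendstoInDistribution X' atTop Z (fun _ => μ') Q where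
  forall_aemeasurable := hX'
  aemeasurable_limit := h.aemeasurable_limit
  tendsto := by
    refine h.tendsto.congr' ?_
    filter_upwards [hd] with m hm
    exact Subtype.ext hm.map_eq

/-- Slutsky's lemma for extended nonnegative random variables. -/
lemma MeasureTheory.TendstoInDistribution.of_isLittleOP {X Y R : ℕ → Ω → ℝ≥0∞} {Z : Ω₀ → ℝ≥0∞}
    (h : TendstoInDistribution X atTop Z (fun _ => μ) Q)
    (hY : ∀ m, AEMeasurable (Y m) μ) (hR : IsLittleOP μ R)
    (h1 : ∀ᶠ m in atTop, ∀ ω, X m ω ≤ Y m ω + R m ω)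
    (h2 : ∀ᶠ m in atTop, ∀ ω, Y m ω ≤ X m ω + R m ω) :
    TendstoInDistribution Y atTop Z (fun _ => μ) Q := by
  -- There is no usable difference in [0, ∞]. The map x ↦ 1/(1 + x) is continuous and bounded, has
  -- the continuous left inverse ψ, and does not increase distances; so the real-valued Slutsky
  -- lemma is applied to the images and the result is pulled back by ψ.
  set φ : ℝ≥0∞ → ℝ := fun x => ((1 + x)⁻¹).toReal with hφ
  set ψ : ℝ → ℝ≥0∞ := fun r => (ENNReal.ofReal r)⁻¹ - 1 with hψ
  have hfin : ∀ x : ℝ≥0∞, (1 + x)⁻¹ ≠ ∞ := fun x => by simp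
  have hφc : Continuous φ := by
    rw [continuous_iff_continuousAt]
    intro x
    refine (ENNReal.continuousAt_toReal (hfin x)).comp (f := fun x : ℝ≥0∞ => (1 + x)⁻¹) ?_
    exact ((continuous_inv (G := ℝ≥0∞)).comp
      ((continuous_const (y := (1 : ℝ≥0∞))).add continuous_id)).continuousAt
  have hψc : Continuous ψ :=
    (ENNReal.continuous_sub_right 1).comp ((continuous_inv (G := ℝ≥0∞)).comp ENNReal.continuous_ofReal)
  have hψφ : ∀ x, ψ (φ x) = x := fun x => by
    simp only [hφ, hψ]
    rw [ENNReal.ofReal_toReal (hfin x), inv_inv]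
    exact ENNReal.add_sub_cancel_left (by simp)
  have key : ∀ x y r : ℝ≥0∞, y ≤ x + r → ∀ ε : ℝ, 0 < ε → r < ENNReal.ofReal ε →
      φ x - φ y < ε := by
    intro x y r hyx ε hε hr
    have hφ0 : 0 ≤ φ y := ENNReal.toReal_nonneg
    -- At x = ∞ the claim is trivial because φ x = 0; otherwise r, and with it y, is finite and the
    -- inequality is one between real numbers.
    rcases eq_or_ne x ∞ with rfl | hx
    · have : φ ∞ = 0 := by simp [hφ]
      linarith
    have hr' : r ≠ ∞ := (hr.trans_le le_top).ne
    have hy : y ≠ ∞ := (hyx.trans_lt (ENNReal.add_lt_top.2 ⟨hx.lt_top, hr'.lt_top⟩)).ne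
    lift x to ℝ≥0 using hx
    lift y to ℝ≥0 using hy
    lift r to ℝ≥0 using hr'
    have e : ∀ z : ℝ≥0, φ z = (1 + (z : ℝ))⁻¹ := fun z => by
      simp only [hφ, ENNReal.toReal_inv]
      congr 1
    have hyx' : (y : ℝ) ≤ x + r := by exact_mod_cast hyx
    have hr'' : (r : ℝ) < ε := by
      rw [ENNReal.ofReal, ENNReal.coe_lt_coe] at hr
      simpa [hε.le] using (NNReal.coe_lt_coe.2 hr)
    rw [e, e]
    have hx0 := x.2
    have hy0 := y.2
    have hr0 := r.2
    refine lt_of_le_of_lt ?_ hr''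
    rw [inv_sub_inv (by positivity) (by positivity), div_le_iff₀ (by positivity)]
    have : (0 : ℝ) ≤ x + y + x * y := by positivity
    nlinarith [mul_nonneg hr0 this]
  have hφX := h.continuous_comp hφc
  have hφY : TendstoInDistribution (fun m => φ ∘ Y m) atTop (φ ∘ Z) (fun _ => μ) Q := by
    refine tendstoInDistribution_of_tendstoInMeasure_sub _ _ hφX ?_
      fun m => hφc.measurable.comp_aemeasurable (hY m)
    rw [tendstoInMeasure_iff_norm]
    intro ε hε
    refine tendsto_of_tendsto_of_tendsto_of_le_of_le' tendsto_const_nhds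
      (hR (ENNReal.ofReal ε) (by simpa using hε)) (Eventually.of_forall fun _ => zero_le) ?_
    filter_upwards [h1, h2] with m h1 h2
    refine measure_mono fun ω hω => ?_
    replace hω : ε ≤ ‖φ (Y m ω) - φ (X m ω) - 0‖ := hω
    rw [sub_zero] at hω
    change ENNReal.ofReal ε ≤ R m ω
    by_contra hcon
    rw [not_le] at hcon
    have a1 := key _ _ _ (h1 ω) ε hε hcon
    have a2 := key _ _ _ (h2 ω) ε hε hcon
    rw [Real.norm_eq_abs, le_abs] at hω
    rcases hω with h | h <;> linarith
  have := hφY.continuous_comp hψc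
  have eY : (fun m => ψ ∘ φ ∘ Y m) = Y := by funext m ω; exact hψφ _
  have eZ : ψ ∘ φ ∘ Z = Z := by funext ω; exact hψφ _
  rwa [eY, eZ] at this

end Distribution

/-! ### Suprema over the triangle m ≤ j < k. -/

section TriSup

/-- The supremum of `f j k` over all `m ≤ j < k`. -/
noncomputable def triSup (m : ℕ) (f : ℕ → ℕ → ℝ) : ℝ≥0∞ :=
  ⨆ (k : ℕ) (_ : m < k) (j : ℕ) (_ : m ≤ j) (_ : j < k), ENNReal.ofReal (f j k)

variable {m : ℕ} {f g h : ℕ → ℕ → ℝ}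

lemma triSup_le {c : ℝ≥0∞} (hf : ∀ j k, m ≤ j → j < k → ENNReal.ofReal (f j k) ≤ c) :
    triSup m f ≤ c :=
  iSup₂_le fun k _ => iSup₂_le fun j hj => iSup_le fun hk => hf j k hj hk

lemma le_triSup {j k : ℕ} (hj : m ≤ j) (hk : j < k) : ENNReal.ofReal (f j k) ≤ triSup m f :=
  le_iSup₂_of_le k (hj.trans_lt hk) <| le_iSup₂_of_le j hj <| le_iSup_of_le hk le_rfl

lemma triSup_le_add (hf : ∀ j k, m ≤ j → j < k → f j k ≤ g j k + h j k) :
    triSup m f ≤ triSup m g + triSup m h :=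
  triSup_le fun j k hj hk => (ENNReal.ofReal_le_ofReal (hf j k hj hk)).trans <|
    ENNReal.ofReal_add_le.trans <| add_le_add (le_triSup hj hk) (le_triSup hj hk)

lemma measurable_triSup {α : Type*} [MeasurableSpace α] {F : α → ℕ → ℕ → ℝ}
    (hF : ∀ j k, Measurable fun a => F a j k) : Measurable fun a => triSup m (F a) := by
  unfold triSup
  exact .iSup fun k => .iSup fun _ => .iSup fun j => .iSup fun _ => .iSup fun _ =>
    (hF j k).ennreal_ofReal

end TriSup

/-! ### The CUSUM statistic of a path: linearity, drift invariance, size. -/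

section Cusum

variable {p : ℕ}

/-- The weighted statistic `(m / k) ^ (3 / 2 + η) m ^ (-3 / 2) (k a_j - j a_k)` of a sequence `a`
of partial sums. -/
noncomputable def cusum (η : ℝ) (m : ℕ) (a : ℕ → Fin p → ℝ) (j k : ℕ) : Fin p → ℝ :=
  (((m : ℝ) / k) ^ (3 / 2 + η : ℝ) / (m : ℝ) ^ (3 / 2 : ℝ)) • ((k : ℝ) • a j - (j : ℝ) • a k)

variable {η : ℝ} {m j k : ℕ} {a b : ℕ → Fin p → ℝ}

lemma cusum_sub : cusum η m (fun n => a n - b n) j k = cusum η m a j k - cusum η m b j k := by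
  unfold cusum
  ext i
  simp only [Pi.smul_apply, Pi.sub_apply, smul_eq_mul]
  ring

/-- This makes every centring free: c may depend on m and on the outcome, only not on n. -/
lemma cusum_drift (c : Fin p → ℝ) : cusum η m (fun n => (n : ℝ) • c) j k = 0 := by
  unfold cusum
  ext i
  simp only [Pi.smul_apply, Pi.sub_apply, smul_eq_mul, Pi.zero_apply]
  ring

lemma cusum_mulVec (A : Matrix (Fin p) (Fin p) ℝ) :
    cusum η m (fun n => A *ᵥ a n) j k = A *ᵥ cusum η m a j k := by
  unfold cusum
  rw [Matrix.mulVec_smul, Matrix.mulVec_sub, Matrix.mulVec_smul, Matrix.mulVec_smul]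

lemma cusum_weight (hm : 1 ≤ m) (hk : m ≤ k) :
    ((m : ℝ) / k) ^ (3 / 2 + η : ℝ) / (m : ℝ) ^ (3 / 2 : ℝ) * k
      = (m : ℝ) ^ η * (k : ℝ) ^ (-(1 / 2) - η) := by
  have hm' : (0 : ℝ) < m := by exact_mod_cast hm
  have hk' : (0 : ℝ) < k := by exact_mod_cast hm.trans hk
  rw [Real.div_rpow hm'.le hk'.le, Real.rpow_add hm', Real.rpow_sub hk', Real.rpow_neg hk'.le,
    show (3 / 2 + η : ℝ) = 1 + 1 / 2 + η by ring, Real.rpow_add hk' _ η, Real.rpow_add hk' 1,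
    Real.rpow_one]
  have := Real.rpow_pos_of_pos hm' (3 / 2)
  field_simp

/-- Both coefficients j and k are at most k, and `cusum_weight` absorbs that k. The factor (m/k)^η
is kept because Brownian paths, of size about √k, need it. -/
lemma norm_cusum_le (hm : 1 ≤ m) (hj : m ≤ j) (hk : j < k) :
    ‖cusum η m a j k‖ ≤ (m : ℝ) ^ η * (k : ℝ) ^ (-(1 / 2) - η) * (‖a j‖ + ‖a k‖) := by
  rw [← cusum_weight hm (hj.trans hk.le)]
  unfold cusum
  set c := ((m : ℝ) / k) ^ (3 / 2 + η : ℝ) / (m : ℝ) ^ (3 / 2 : ℝ)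
  have hc : 0 ≤ c := by positivity
  rw [norm_smul, Real.norm_of_nonneg hc, mul_assoc]
  refine mul_le_mul_of_nonneg_left ?_ hc
  refine (norm_sub_le _ _).trans ?_
  rw [norm_smul, norm_smul, Real.norm_of_nonneg (by positivity),
    Real.norm_of_nonneg (by positivity), mul_add]
  have : (j : ℝ) ≤ k := by exact_mod_cast hk.le
  gcongr

/-- For error terms that are already o(√k), the factor (m/k)^η ≤ 1 can be dropped. -/
lemma norm_cusum_le' (hη : 0 ≤ η) (hm : 1 ≤ m) (hj : m ≤ j) (hk : j < k) :
    ‖cusum η m a j k‖ ≤ (k : ℝ) ^ (-(1 / 2) : ℝ) * (‖a j‖ + ‖a k‖) := by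
  refine (norm_cusum_le hm hj hk).trans ?_
  have hm' : (0 : ℝ) < m := by exact_mod_cast hm
  have hmk : (m : ℝ) ≤ k := by exact_mod_cast (hj.trans hk.le)
  have hk' : (0 : ℝ) < k := hm'.trans_le hmk
  refine mul_le_mul_of_nonneg_right ?_ (by positivity)
  rw [Real.rpow_sub hk', mul_div_left_comm]
  refine mul_le_of_le_one_right (by positivity) ?_
  rw [div_le_one (by positivity)]
  gcongr

lemma measurable_cusum {α : Type*} [MeasurableSpace α] {A : α → ℕ → Fin p → ℝ}
    (hA : ∀ n, Measurable fun x => A x n) : Measurable fun x => cusum η m (A x) j k := by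
  unfold cusum
  have := hA j
  have := hA k
  fun_prop

end Cusum

/-! ### Weighted norms: continuity, measurability, replacement of the matrix. -/

section WNorm

variable {p : ℕ}

lemma wnorm_smul (M : Matrix (Fin p) (Fin p) ℝ) {c : ℝ} (hc : 0 ≤ c) (y : Fin p → ℝ) :
    wnorm M (c • y) = c * wnorm M y := by
  unfold wnorm
  rw [Matrix.mulVec_smul, smul_dotProduct, dotProduct_smul, smul_eq_mul, smul_eq_mul, ← mul_assoc,
    mul_div_assoc, Real.sqrt_mul (by positivity), ← sq, Real.sqrt_sq hc]

lemma continuous_wnorm :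
    Continuous fun q : Matrix (Fin p) (Fin p) ℝ × (Fin p → ℝ) => wnorm q.1 q.2 := by
  unfold wnorm
  refine Real.continuous_sqrt.comp (Continuous.div_const ?_ _)
  exact continuous_snd.dotProduct (continuous_fst.matrix_mulVec continuous_snd)

/-- The inverse is the adjugate divided by the determinant, hence continuous where the determinant
does not vanish. Matrices are viewed as functions so as to carry the product metric. -/
lemma continuousAt_wnorm_inv {S : Matrix (Fin p) (Fin p) ℝ} (hS : S.det ≠ 0) (y : Fin p → ℝ) :
    ContinuousAt (fun q : (Fin p → Fin p → ℝ) × (Fin p → ℝ) => wnorm (Matrix.of q.1)⁻¹ q.2)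
      (Matrix.of.symm S, y) := by
  have hof : Continuous fun q : (Fin p → Fin p → ℝ) × (Fin p → ℝ) => Matrix.of q.1 :=
    continuous_fst
  refine continuous_wnorm.continuousAt.comp
    (f := fun q : (Fin p → Fin p → ℝ) × (Fin p → ℝ) => ((Matrix.of q.1)⁻¹, q.2)) ?_
  refine ContinuousAt.prodMk ?_ continuousAt_snd
  simp_rw [Matrix.inv_def, Ring.inverse_eq_inv']
  refine ContinuousAt.smul (f := fun q : (Fin p → Fin p → ℝ) × (Fin p → ℝ) =>
    (Matrix.of q.1).det⁻¹) ?_ hof.matrix_adjugate.continuousAt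
  exact ContinuousAt.inv₀ hof.matrix_det.continuousAt hS

lemma Matrix.measurable_det {α : Type*} [MeasurableSpace α] {A : α → Matrix (Fin p) (Fin p) ℝ}
    (hA : ∀ i j, Measurable fun x => A x i j) : Measurable fun x => (A x).det := by
  simp_rw [Matrix.det_apply]
  exact Finset.measurable_sum _ fun σ _ =>
    (Finset.measurable_prod _ fun i _ => hA _ _).const_smul _

lemma Matrix.measurable_inv {α : Type*} [MeasurableSpace α] {A : α → Matrix (Fin p) (Fin p) ℝ}
    (hA : ∀ i j, Measurable fun x => A x i j) (i j : Fin p) :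
    Measurable fun x => (A x)⁻¹ i j := by
  simp_rw [Matrix.inv_def, Ring.inverse_eq_inv', Matrix.smul_apply, Matrix.adjugate_apply,
    smul_eq_mul]
  refine (Matrix.measurable_det hA).inv.mul (Matrix.measurable_det fun a b => ?_)
  simp only [Matrix.updateRow_apply]
  split_ifs
  · exact measurable_const
  · exact hA a b

lemma measurable_wnorm_inv {α : Type*} [MeasurableSpace α] {A : α → Matrix (Fin p) (Fin p) ℝ}
    {y : α → Fin p → ℝ} (hA : ∀ i j, Measurable fun x => A x i j) (hy : Measurable y) :
    Measurable fun x => wnorm (A x)⁻¹ (y x) := by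
  have hy' : ∀ i, Measurable fun x => y x i := fun i => (measurable_pi_apply i).comp hy
  unfold wnorm dotProduct Matrix.mulVec dotProduct
  exact ((Finset.measurable_sum _ fun i _ => (hy' i).mul <| Finset.measurable_sum _ fun j _ =>
    (Matrix.measurable_inv hA i j).mul (hy' j)).div_const _).sqrt

/-- The scaled distance between two quadratic norms is negligible when the (inverted) matrices
converge in probability and the vectors are uniformly close and stochastically bounded. -/
lemma isLittleOP_wnorm_sub {Ω : Type*} [MeasurableSpace Ω] {μ : Measure Ω}
    {A : ℕ → Ω → Matrix (Fin p) (Fin p) ℝ} {S : Matrix (Fin p) (Fin p) ℝ} (hS : S.det ≠ 0)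
    (hA : ∀ a b, TendstoInMeasure μ (fun m ω => A m ω a b) atTop (fun _ => S a b))
    {x y : ℕ → Ω → ℕ → ℕ → Fin p → ℝ}
    (hxy : IsLittleOP μ fun m ω => triSup m fun j k => ‖x m ω j k - y m ω j k‖)
    (hy : IsBigOP μ fun m ω => triSup m fun j k => ‖y m ω j k‖) :
    IsLittleOP μ fun m ω => triSup m fun j k =>
      |wnorm (A m ω)⁻¹ (x m ω j k) - wnorm S⁻¹ (y m ω j k)| := by
  intro ε hε
  rw [ENNReal.tendsto_nhds_zero]
  intro r hr
  obtain ⟨ε', hε'0, hε'⟩ : ∃ ε' : ℝ, 0 < ε' ∧ ENNReal.ofReal ε' < ε := by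
    obtain ⟨q, hq0, hq⟩ := ENNReal.lt_iff_exists_nnreal_btwn.1 hε
    refine ⟨q, by exact_mod_cast hq0, by simpa using hq⟩
  have hr3 : 0 < r / 3 := ENNReal.div_pos hr.ne' (by simp)
  obtain ⟨K, hK⟩ := hy _ hr3
  -- One δ must serve all pairs (j, k). Continuity at each point of the compact set {S} × ball gives
  -- it: the y's stay in the ball with high probability, and the second argument of the comparison
  -- may leave it.
  have hcomp : IsCompact (({Matrix.of.symm S} : Set (Fin p → Fin p → ℝ)) ×ˢ
      Metric.closedBall (0 : Fin p → ℝ) K) := isCompact_singleton.prod (isCompact_closedBall _ _)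
  have huc := hcomp.uniformContinuousAt_of_continuousAt
    (fun q : (Fin p → Fin p → ℝ) × (Fin p → ℝ) => wnorm (Matrix.of q.1)⁻¹ q.2)
    (by rintro ⟨q1, q2⟩ ⟨hq1, -⟩
        obtain rfl : q1 = Matrix.of.symm S := hq1
        exact continuousAt_wnorm_inv hS q2) (Metric.dist_mem_uniformity hε'0)
  obtain ⟨δ, hδ0, hδ⟩ := Metric.mem_uniformity_dist.1 huc
  have hA' : Tendsto (fun m => ∑ a, ∑ b,
      μ {ω | ENNReal.ofReal (δ / 2) ≤ edist (A m ω a b) (S a b)}) atTop (𝓝 0) := by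
    have : Tendsto (fun m => ∑ a, ∑ b,
      μ {ω | ENNReal.ofReal (δ / 2) ≤ edist (A m ω a b) (S a b)}) atTop
        (𝓝 (∑ _a : Fin p, ∑ _b : Fin p, 0)) :=
      tendsto_finsetSum _ fun a _ => tendsto_finsetSum _ fun b _ =>
        hA a b _ (by simpa using hδ0)
    simpa using this
  have hxy' := hxy (ENNReal.ofReal (δ / 2)) (by simpa using hδ0)
  filter_upwards [hK, hA'.eventually (gt_mem_nhds hr3), hxy'.eventually (gt_mem_nhds hr3)]
    with m h1 h2 h3
  have hsub : {ω | ε ≤ triSup m fun j k =>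
      |wnorm (A m ω)⁻¹ (x m ω j k) - wnorm S⁻¹ (y m ω j k)|} ⊆
      ({ω | (K : ℝ≥0∞) < triSup m fun j k => ‖y m ω j k‖} ∪
        ⋃ a, ⋃ b, {ω | ENNReal.ofReal (δ / 2) ≤ edist (A m ω a b) (S a b)}) ∪
        {ω | ENNReal.ofReal (δ / 2) ≤ triSup m fun j k => ‖x m ω j k - y m ω j k‖} := by
    intro ω hω
    by_contra hcon
    simp only [Set.mem_union, Set.mem_iUnion, Set.mem_ofPred_eq, not_or, not_exists, not_le,
      not_lt] at hcon
    obtain ⟨⟨c1, c2⟩, c3⟩ := hcon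
    refine absurd (show ε ≤ _ from hω) (not_le.2 (lt_of_le_of_lt (triSup_le ?_) hε'))
    intro j k hj hk
    refine ENNReal.ofReal_le_ofReal ?_
    have d1 : ‖y m ω j k‖ ≤ K := by
      have := (le_triSup (f := fun j k => ‖y m ω j k‖) hj hk).trans c1
      rwa [ENNReal.ofReal_le_iff_le_toReal (by simp), ENNReal.coe_toReal] at this
    have d3 : ‖x m ω j k - y m ω j k‖ < δ / 2 := by
      have := (le_triSup (f := fun j k => ‖x m ω j k - y m ω j k‖) hj hk).trans_lt c3
      exact (ENNReal.ofReal_lt_ofReal_iff (by positivity)).1 this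
    have d2 : ∀ a b, dist (S a b) (A m ω a b) ≤ δ / 2 := fun a b => by
      have := (c2 a b).le
      rw [edist_dist, ENNReal.ofReal_le_ofReal_iff (by positivity)] at this
      rwa [dist_comm]
    have := @hδ (Matrix.of.symm S, y m ω j k) (Matrix.of.symm (A m ω), x m ω j k) ?_
      ⟨rfl, by simpa using d1⟩
    · rw [Set.mem_ofPred_eq, Real.dist_eq, abs_sub_comm] at this
      exact this.le
    · rw [Prod.dist_eq, max_lt_iff]
      refine ⟨lt_of_le_of_lt ((dist_pi_le_iff (by positivity)).2 fun a =>
        (dist_pi_le_iff (by positivity)).2 fun b => d2 a b) (half_lt_self hδ0), ?_⟩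
      rw [dist_comm, dist_eq_norm]
      exact d3.trans (half_lt_self hδ0)
  refine (measure_mono hsub).trans <| (measure_union_le _ _).trans <|
    (add_le_add ((measure_union_le _ _).trans (add_le_add h1 ?_)) h3.le).trans
      (ENNReal.add_thirds r).le
  refine (measure_iUnion_fintype_le _ _).trans <|
    (Finset.sum_le_sum fun a _ => measure_iUnion_fintype_le _ _).trans h2.le

end WNorm

/-! ### Maximal inequalities and the growth of Brownian motion. -/

section Maximal

variable {Ω : Type*} [MeasurableSpace Ω] {μ : Measure Ω} [IsProbabilityMeasure μ]

/-- Expanding the square of S_{n+1} = S_n + f_{n+1} over an event of the past, the cross term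
vanishes by independence and centring, and the remaining term is nonnegative. -/
lemma submartingale_sum_sq {f : ℕ → Ω → ℝ} (hf : ∀ i, StronglyMeasurable (f i))
    (hind : iIndepFun f μ) (hL : ∀ i, MemLp (f i) 2 μ) (h0 : ∀ i, ∫ ω, f i ω ∂μ = 0) :
    Submartingale (fun n ω => (∑ i ∈ Finset.range (n + 1), f i ω) ^ 2)
      (Filtration.natural f hf) μ := by
  set S : ℕ → Ω → ℝ := fun n ω => ∑ i ∈ Finset.range (n + 1), f i ω with hS
  have hSL : ∀ n, MemLp (S n) 2 μ := fun n => memLp_finsetSum _ fun i _ => hL i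
  have hadp : ∀ n, StronglyMeasurable[Filtration.natural f hf n] (S n) := fun n =>
    Finset.stronglyMeasurable_fun_sum _ fun i hi =>
      ((Filtration.stronglyAdapted_natural hf i).mono
        ((Filtration.natural f hf).mono (Nat.lt_succ_iff.1 (Finset.mem_range.1 hi))))
  refine submartingale_of_setIntegral_le_succ (fun n => (hadp n).pow 2)
    (fun n => (hSL n).integrable_sq) fun n s hs => ?_
  have hs' : MeasurableSet s := (Filtration.natural f hf).le n s hs
  have hsum : ∀ ω, S (n + 1) ω = S n ω + f (n + 1) ω := fun ω => Finset.sum_range_succ _ _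
  have hcross : ∫ ω in s, S n ω * f (n + 1) ω ∂μ = 0 := by
    have hI : IndepFun (f (n + 1)) (s.indicator (S n)) μ := by
      have hi := hind.indep_comap_natural_of_lt hf (Nat.lt_succ_self n)
      rw [IndepFun_iff_Indep]
      refine indep_of_indep_of_le_right hi ?_
      exact ((hadp n).indicator hs).measurable.comap_le
    have := hI.integral_mul_eq_mul_integral (hf _).aestronglyMeasurable
      (((hSL n).aestronglyMeasurable).indicator hs')
    rw [h0, zero_mul] at this
    rw [← integral_indicator hs', ← this]
    congr 1
    funext ω
    by_cases hω : ω ∈ s <;> simp [hω, mul_comm]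
  have i1 : Integrable (fun ω => S n ω ^ 2) (μ.restrict s) := (hSL n).integrable_sq.restrict
  have i2 : Integrable (fun ω => S n ω * f (n + 1) ω) (μ.restrict s) :=
    ((hSL n).integrable_mul (hL (n + 1))).restrict
  have i3 : Integrable (fun ω => f (n + 1) ω ^ 2) (μ.restrict s) :=
    (hL (n + 1)).integrable_sq.restrict
  have heq : ∫ ω in s, S (n + 1) ω ^ 2 ∂μ
      = ∫ ω in s, S n ω ^ 2 ∂μ + 2 * ∫ ω in s, S n ω * f (n + 1) ω ∂μ
        + ∫ ω in s, f (n + 1) ω ^ 2 ∂μ := by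
    rw [← integral_const_mul, ← integral_add i1 (i2.const_mul 2)]
    refine Eq.trans ?_ (integral_add (i1.add (i2.const_mul 2)) i3)
    congr 1
    funext ω
    simp only [hsum]
    ring
  change ∫ ω in s, S n ω ^ 2 ∂μ ≤ ∫ ω in s, S (n + 1) ω ^ 2 ∂μ
  rw [heq, hcross]
  have : 0 ≤ ∫ ω in s, f (n + 1) ω ^ 2 ∂μ := integral_nonneg fun ω => sq_nonneg _
  linarith

/-- **Kolmogorov's maximal inequality**. -/
lemma measure_exists_le_abs_sum_le {f : ℕ → Ω → ℝ} (hf : ∀ i, StronglyMeasurable (f i))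
    (hind : iIndepFun f μ) (hL : ∀ i, MemLp (f i) 2 μ) (h0 : ∀ i, ∫ ω, f i ω ∂μ = 0)
    {r : ℝ} (hr : 0 < r) (n : ℕ) :
    μ {ω | ∃ k ≤ n, r ≤ |∑ i ∈ Finset.range (k + 1), f i ω|} ≤
      ENNReal.ofReal ((∫ ω, (∑ i ∈ Finset.range (n + 1), f i ω) ^ 2 ∂μ) / r ^ 2) := by
  have hsub := submartingale_sum_sq hf hind hL h0
  have hr2 : 0 < r ^ 2 := by positivity
  have hcoe : ((r ^ 2).toNNReal : ℝ) = r ^ 2 := Real.coe_toNNReal _ hr2.le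
  have hmax := maximal_ineq hsub (fun n ω => sq_nonneg _) (ε := (r ^ 2).toNNReal) n
  have hset : {ω | ∃ k ≤ n, r ≤ |∑ i ∈ Finset.range (k + 1), f i ω|} ⊆
      {ω | ((r ^ 2).toNNReal : ℝ) ≤ (Finset.range (n + 1)).sup' Finset.nonempty_range_add_one
        fun k => (∑ i ∈ Finset.range (k + 1), f i ω) ^ 2} := by
    rintro ω ⟨k, hk, hk'⟩
    refine le_trans ?_ (Finset.le_sup' (fun k => (∑ i ∈ Finset.range (k + 1), f i ω) ^ 2)
      (Finset.mem_range.2 (Nat.lt_succ_of_le hk)))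
    rw [hcoe, ← sq_abs (∑ i ∈ Finset.range (k + 1), f i ω)]
    exact pow_le_pow_left₀ hr.le hk' 2
  have hint : Integrable (fun ω => (∑ i ∈ Finset.range (n + 1), f i ω) ^ 2) μ :=
    hsub.integrable n
  have hle := hmax.trans (ENNReal.ofReal_le_ofReal
    (setIntegral_le_integral hint (ae_of_all _ fun ω => sq_nonneg _)))
  refine (measure_mono hset).trans ?_
  rw [ENNReal.ofReal_div_of_pos hr2, ENNReal.le_div_iff_mul_le (by simp [hr.ne']) (by simp),
    mul_comm]
  exact hle

/-- Kolmogorov's inequality for the unit-time increments, whose total variance up to N is N. -/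
lemma ProbabilityTheory.IsPreBrownianReal.measure_exists_le_abs_le {B : ℝ≥0 → Ω → ℝ}
    (hB : IsPreBrownianReal B μ) {r : ℝ} (hr : 0 < r) (N : ℕ) :
    μ {ω | ∃ k : ℕ, k ≤ N ∧ r ≤ |B k ω|} ≤ ENNReal.ofReal (N / r ^ 2) := by
  have hzero := hB.eval_zero_ae_eq_zero
  rcases N with _ | n
  · have : μ {ω | ∃ k : ℕ, k ≤ 0 ∧ r ≤ |B k ω|} ≤ 0 := by
      rw [nonpos_iff_eq_zero]
      refine measure_mono_null ?_ (ae_iff.1 hzero)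
      rintro ω ⟨k, hk, hk'⟩ h
      obtain rfl : k = 0 := by omega
      rw [Nat.cast_zero, h, abs_zero] at hk'
      linarith
    exact this.trans zero_le
  have hmono : Monotone fun i : ℕ => (i : ℝ≥0) := Nat.mono_cast
  have hincr := hB.hasIndepIncrements.nat hmono
  have hae : ∀ i : ℕ, AEMeasurable (fun ω => B ((i + 1 : ℕ) : ℝ≥0) ω - B (i : ℝ≥0) ω) μ :=
    fun i => (hB.aemeasurable _).sub (hB.aemeasurable _)
  -- The increments are only almost everywhere measurable, while the natural filtration requires
  -- measurable variables.
  set f : ℕ → Ω → ℝ := fun i => (hae i).mk _ with hf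
  have hfe : ∀ i : ℕ, (fun ω => B ((i + 1 : ℕ) : ℝ≥0) ω - B (i : ℝ≥0) ω) =ᵐ[μ] f i :=
    fun i => (hae i).ae_eq_mk
  have hfm : ∀ i, StronglyMeasurable (f i) := fun i => (hae i).measurable_mk.stronglyMeasurable
  have hsub : ∀ i : ℕ, MemLp (fun ω => B ((i + 1 : ℕ) : ℝ≥0) ω - B (i : ℝ≥0) ω) 2 μ := fun i =>
    ((hB.isGaussianProcess.hasGaussianLaw_eval _).memLp_two).sub
      ((hB.isGaussianProcess.hasGaussianLaw_eval _).memLp_two)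
  have hL : ∀ i, MemLp (f i) 2 μ := fun i => (hsub i).ae_eq (hfe i)
  have h0 : ∀ i, ∫ ω, f i ω ∂μ = 0 := fun i => by
    rw [← integral_congr_ae (hfe i), integral_sub (hB.integrable_eval _) (hB.integrable_eval _),
      hB.integral_eval, hB.integral_eval, sub_zero]
  have hS : ∀ᵐ ω ∂μ, B 0 ω = 0 ∧
      ∀ k : ℕ, ∑ i ∈ Finset.range (k + 1), f i ω = B ((k + 1 : ℕ) : ℝ≥0) ω := by
    filter_upwards [hzero, ae_all_iff.2 hfe] with ω h1 h2
    refine ⟨h1, fun k => ?_⟩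
    rw [← Finset.sum_congr rfl fun i _ => h2 i,
      Finset.sum_range_sub (fun i : ℕ => B (i : ℝ≥0) ω), Nat.cast_zero, h1, sub_zero]
  have hmax := measure_exists_le_abs_sum_le hfm (hincr.congr hfe) hL h0 hr n
  have hvar : ∫ ω, (∑ i ∈ Finset.range (n + 1), f i ω) ^ 2 ∂μ = ((n + 1 : ℕ) : ℝ) := by
    rw [integral_congr_ae (g := fun ω => B ((n + 1 : ℕ) : ℝ≥0) ω ^ 2)]
    · have hc := hB.covariance_eval ((n + 1 : ℕ) : ℝ≥0) ((n + 1 : ℕ) : ℝ≥0)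
      rw [covariance_self (hB.aemeasurable _), variance_eq_integral (hB.aemeasurable _),
        hB.integral_eval] at hc
      simpa using hc
    · filter_upwards [hS] with ω hω
      rw [hω.2]
  rw [hvar] at hmax
  refine le_trans (measure_mono_ae ?_) hmax
  filter_upwards [hS] with ω hω
  rintro ⟨k, hk, hk'⟩
  rcases k with _ | k
  · rw [Nat.cast_zero, hω.1, abs_zero] at hk'
    linarith
  · exact ⟨k, by omega, by rwa [hω.2]⟩

/-- The constant of the growth bound for Brownian motion. -/
noncomputable def growthConst (η : ℝ) : ℝ := 2 * (1 - (2 : ℝ) ^ (-(2 * η)))⁻¹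

/-- Cut the times j ≥ m into blocks from m 2^n to m 2^(n+1) and apply the maximal inequality up to
the end of each. The block bounds form a geometric series of ratio 2^(-2η) in which m cancels, so
the estimate is uniform in m. -/
lemma ProbabilityTheory.IsPreBrownianReal.measure_growth_le {B : ℝ≥0 → Ω → ℝ}
    (hB : IsPreBrownianReal B μ) {η : ℝ} (hη : 0 < η) {m : ℕ} (hm : 1 ≤ m) {r : ℝ} (hr : 0 < r) :
    μ {ω | ∃ j : ℕ, m ≤ j ∧ r ≤ (m : ℝ) ^ η * (j : ℝ) ^ (-(1 / 2) - η) * |B j ω|} ≤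
      ENNReal.ofReal (growthConst η / r ^ 2) := by
  have hm0 : (0 : ℝ) < m := by exact_mod_cast hm
  set q : ℝ := (2 : ℝ) ^ (-(2 * η)) with hq
  have hq0 : 0 ≤ q := by positivity
  have hq1 : q < 1 := Real.rpow_lt_one_of_one_lt_of_neg one_lt_two (by linarith)
  -- The event at j says that |B j| ≥ r m^(-η) j^(1/2 + η); ρ n is this threshold at the left end of
  -- the n-th block.
  set ρ : ℕ → ℝ := fun n => r * (m : ℝ) ^ (-η) * ((m : ℝ) * 2 ^ n) ^ (1 / 2 + η) with hρ
  have hρ0 : ∀ n, 0 < ρ n := fun n => by positivity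
  have hsub : {ω | ∃ j : ℕ, m ≤ j ∧ r ≤ (m : ℝ) ^ η * (j : ℝ) ^ (-(1 / 2) - η) * |B j ω|} ⊆
      ⋃ n : ℕ, {ω | ∃ k : ℕ, k ≤ m * 2 ^ (n + 1) ∧ ρ n ≤ |B k ω|} := by
    rintro ω ⟨j, hj, hj'⟩
    have hj0 : (0 : ℝ) < j := hm0.trans_le (by exact_mod_cast hj)
    have hdiv : j / m ≠ 0 := (Nat.div_pos hj hm).ne'
    refine Set.mem_iUnion.2 ⟨Nat.log 2 (j / m), j, ?_, ?_⟩
    · have := Nat.lt_pow_succ_log_self one_lt_two (j / m)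
      exact ((Nat.div_lt_iff_lt_mul hm).1 this).le.trans (by rw [mul_comm])
    · have h1 : m * 2 ^ Nat.log 2 (j / m) ≤ j :=
        (Nat.mul_le_mul_left m (Nat.pow_log_le_self 2 hdiv)).trans (Nat.mul_div_le j m)
      have h2 : (m : ℝ) * 2 ^ Nat.log 2 (j / m) ≤ j := by exact_mod_cast h1
      have h3 : ((m : ℝ) * 2 ^ Nat.log 2 (j / m)) ^ (1 / 2 + η) ≤ (j : ℝ) ^ (1 / 2 + η) := by
        gcongr
      calc ρ (Nat.log 2 (j / m)) ≤ r * (m : ℝ) ^ (-η) * (j : ℝ) ^ (1 / 2 + η) := by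
            simp only [hρ]
            gcongr
        _ ≤ ((m : ℝ) ^ η * (j : ℝ) ^ (-(1 / 2) - η) * |B j ω|) * (m : ℝ) ^ (-η) *
            (j : ℝ) ^ (1 / 2 + η) := by gcongr
        _ = |B j ω| * ((m : ℝ) ^ η * (m : ℝ) ^ (-η)) *
            ((j : ℝ) ^ (-(1 / 2) - η) * (j : ℝ) ^ (1 / 2 + η)) := by ring
        _ = |B j ω| := by
            rw [← Real.rpow_add hm0, ← Real.rpow_add hj0]
            simp
  have hterm : ∀ n : ℕ, ((m * 2 ^ (n + 1) : ℕ) : ℝ) / ρ n ^ 2 = 2 / r ^ 2 * q ^ n := by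
    intro n
    have e1 : ((m : ℝ) ^ (-η)) ^ 2 = (m : ℝ) ^ (-(2 * η)) := by
      rw [← Real.rpow_natCast, ← Real.rpow_mul hm0.le]
      congr 1
      push_cast
      ring
    have e2 : (((m : ℝ) * 2 ^ n) ^ (1 / 2 + η)) ^ 2
        = (m : ℝ) * 2 ^ n * ((m : ℝ) ^ (2 * η) * (q ^ n)⁻¹) := by
      rw [← Real.rpow_natCast, ← Real.rpow_mul (by positivity),
        show (1 / 2 + η) * ((2 : ℕ) : ℝ) = 1 + 2 * η by push_cast; ring,
        Real.rpow_add (by positivity), Real.rpow_one, Real.mul_rpow hm0.le (by positivity)]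
      congr 2
      rw [hq, ← inv_pow, Real.rpow_neg zero_le_two, inv_inv, ← Real.rpow_natCast,
        ← Real.rpow_natCast, ← Real.rpow_mul zero_le_two, ← Real.rpow_mul zero_le_two, mul_comm]
    have e3 : (m : ℝ) ^ (-(2 * η)) * (m : ℝ) ^ (2 * η) = 1 := by
      rw [← Real.rpow_add hm0]
      simp
    have e4 : ρ n ^ 2 = r ^ 2 * ((m : ℝ) * 2 ^ n) * (q ^ n)⁻¹ := by
      simp only [hρ]
      rw [mul_pow, mul_pow, e1, e2]
      linear_combination (r ^ 2 * ((m : ℝ) * 2 ^ n) * (q ^ n)⁻¹) * e3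
    have hqn : 0 < q ^ n := by positivity
    rw [e4]
    push_cast
    field_simp
    ring
  calc _ ≤ _ := measure_mono hsub
    _ ≤ ∑' n : ℕ, μ {ω | ∃ k : ℕ, k ≤ m * 2 ^ (n + 1) ∧ ρ n ≤ |B k ω|} := measure_iUnion_le _
    _ ≤ ∑' n : ℕ, ENNReal.ofReal (2 / r ^ 2 * q ^ n) :=
        ENNReal.tsum_le_tsum fun n => hterm n ▸ hB.measure_exists_le_abs_le (hρ0 n) _
    _ = ENNReal.ofReal (growthConst η / r ^ 2) := by
        rw [← ENNReal.ofReal_tsum_of_nonneg (fun n => by positivity)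
          ((summable_geometric_of_lt_one hq0 hq1).mul_left _), tsum_mul_left,
          tsum_geometric_of_lt_one hq0 hq1]
        congr 1
        unfold growthConst
        ring

lemma measure_le_triSup_cusum_le {p : ℕ} {B : ℝ≥0 → Ω → Fin p → ℝ}
    (hB : ∀ i, IsPreBrownianReal (fun t ω => B t ω i) μ) {η : ℝ} (hη : 0 < η) {m : ℕ}
    (hm : 1 ≤ m) {r : ℝ} (hr : 0 < r) :
    μ {ω | ENNReal.ofReal r ≤ triSup m fun j k => ‖cusum η m (fun n => B n ω) j k‖} ≤
      p * ENNReal.ofReal (growthConst η / (r / 4) ^ 2) := by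
  have hm0 : (0 : ℝ) < m := by exact_mod_cast hm
  have hsub : {ω | ENNReal.ofReal r ≤ triSup m fun j k => ‖cusum η m (fun n => B n ω) j k‖} ⊆
      ⋃ i : Fin p, {ω | ∃ j : ℕ, m ≤ j ∧
        r / 4 ≤ (m : ℝ) ^ η * (j : ℝ) ^ (-(1 / 2) - η) * |B j ω i|} := by
    intro ω hω
    by_contra hcon
    simp only [Set.mem_iUnion, Set.mem_ofPred_eq, not_exists, not_and, not_le] at hcon
    have hj0 : ∀ j : ℕ, m ≤ j →
        (m : ℝ) ^ η * (j : ℝ) ^ (-(1 / 2) - η) * ‖B j ω‖ ≤ r / 4 := by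
      intro j hj
      have hj' : (0 : ℝ) < j := hm0.trans_le (by exact_mod_cast hj)
      have hc : 0 < (m : ℝ) ^ η * (j : ℝ) ^ (-(1 / 2) - η) := by positivity
      rw [mul_comm, ← le_div_iff₀ hc]
      refine (pi_norm_le_iff_of_nonneg (by positivity)).2 fun i => ?_
      rw [le_div_iff₀ hc, mul_comm]
      exact (hcon i j hj).le
    -- The j-term and the k-term contribute at most r/4 each. The slack between r/2 and r survives
    -- passage to the supremum, which need not be attained.
    have hlt : ENNReal.ofReal (r / 2) < ENNReal.ofReal r :=
      (ENNReal.ofReal_lt_ofReal_iff hr).2 (half_lt_self hr)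
    refine absurd (show ENNReal.ofReal r ≤ _ from hω)
      (not_le.2 (lt_of_le_of_lt (triSup_le fun j k hj hk => ?_) hlt))
    refine ENNReal.ofReal_le_ofReal ((norm_cusum_le hm hj hk).trans ?_)
    have h1 := hj0 j hj
    have h2 := hj0 k (hj.trans hk.le)
    have hj' : (0 : ℝ) < j := hm0.trans_le (by exact_mod_cast hj)
    have h3 : (k : ℝ) ^ (-(1 / 2) - η) ≤ (j : ℝ) ^ (-(1 / 2) - η) :=
      Real.rpow_le_rpow_of_nonpos hj' (by exact_mod_cast hk.le) (by linarith)
    have h4 : (m : ℝ) ^ η * (k : ℝ) ^ (-(1 / 2) - η) * ‖B j ω‖ ≤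
        (m : ℝ) ^ η * (j : ℝ) ^ (-(1 / 2) - η) * ‖B j ω‖ := by gcongr
    linarith
  refine (measure_mono hsub).trans <| (measure_iUnion_fintype_le _ _).trans <|
    (Finset.sum_le_sum fun i _ => (hB i).measure_growth_le hη hm (by positivity)).trans ?_
  simp

lemma tendsto_growthConst_div (p : ℕ) (η : ℝ) :
    Tendsto (fun r : ℝ => (p : ℝ≥0∞) * ENNReal.ofReal (growthConst η / (r / 4) ^ 2)) atTop
      (𝓝 0) := by
  have h1 : Tendsto (fun r : ℝ => growthConst η / (r / 4) ^ 2) atTop (𝓝 0) :=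
    tendsto_const_nhds.div_atTop ((tendsto_pow_atTop two_ne_zero).comp
      (tendsto_id.atTop_div_const (by norm_num)))
  have h2 := ENNReal.Tendsto.const_mul (a := (p : ℝ≥0∞)) (ENNReal.tendsto_ofReal h1)
    (Or.inr (by simp))
  simpa using h2

lemma isBigOP_triSup_cusum {p : ℕ} {B : ℕ → ℝ≥0 → Ω → Fin p → ℝ}
    (hB : ∀ m i, IsPreBrownianReal (fun t ω => B m t ω i) μ) {η : ℝ} (hη : 0 < η) :
    IsBigOP μ fun m ω => triSup m fun j k => ‖cusum η m (fun n => B m n ω) j k‖ := by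
  intro ε hε
  have hlim := tendsto_growthConst_div p η
  obtain ⟨r, hr, hr0⟩ := ((hlim.eventually (gt_mem_nhds hε)).and (eventually_gt_atTop 0)).exists
  refine ⟨r.toNNReal, ?_⟩
  filter_upwards [eventually_ge_atTop 1] with m hm
  refine le_trans (measure_mono fun ω hω => ?_)
    ((measure_le_triSup_cusum_le (hB m) hη hm hr0).trans hr.le)
  exact (show ENNReal.ofReal r < _ from hω).le

end Maximal

/-! ### Laws of concatenated and rescaled Brownian motions. -/

section BrownianLaw

variable {Ω Ω' : Type*} [MeasurableSpace Ω] [MeasurableSpace Ω'] {μ : Measure Ω}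
  [IsProbabilityMeasure μ] {μ' : Measure Ω'} [IsProbabilityMeasure μ']

lemma ProbabilityTheory.iIndepFun.prodMk_of_indepFun {ι α β : Type*} [Fintype ι]
    [MeasurableSpace α] [MeasurableSpace β] {F : ι → Ω → α} {G : ι → Ω → β}
    (hF : ∀ i, AEMeasurable (F i) μ) (hG : ∀ i, AEMeasurable (G i) μ)
    (hiF : iIndepFun F μ) (hiG : iIndepFun G μ)
    (hFG : IndepFun (fun ω i => F i ω) (fun ω i => G i ω) μ) :
    iIndepFun (fun i ω => (F i ω, G i ω)) μ := by
  have hFa : AEMeasurable (fun ω i => F i ω) μ := aemeasurable_pi_lambda _ hF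
  have hGa : AEMeasurable (fun ω i => G i ω) μ := aemeasurable_pi_lambda _ hG
  have hpF := fun i => Measure.isProbabilityMeasure_map (hF i)
  have hpG := fun i => Measure.isProbabilityMeasure_map (hG i)
  rw [iIndepFun_iff_map_fun_eq_pi_map fun i => (hF i).prodMk (hG i)]
  have hmarg : ∀ i, μ.map (fun ω => (F i ω, G i ω)) = (μ.map (F i)).prod (μ.map (G i)) := fun i =>
    (indepFun_iff_map_prod_eq_prod_map_map (hF i) (hG i)).1
      (hFG.comp (measurable_pi_apply i) (measurable_pi_apply i))
  simp_rw [hmarg]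
  have hjoint := (indepFun_iff_map_prod_eq_prod_map_map hFa hGa).1 hFG
  rw [(iIndepFun_iff_map_fun_eq_pi_map hF).1 hiF, (iIndepFun_iff_map_fun_eq_pi_map hG).1 hiG]
    at hjoint
  have hmp := measurePreserving_arrowProdEquivProdArrow α β ι (fun i => μ.map (F i))
    (fun i => μ.map (G i))
  -- Equality of laws is checked after rearranging a family of pairs into a pair of families, where
  -- both sides are the product of the two product laws.
  apply (MeasurableEquiv.arrowProdEquivProdArrow α β ι).map_measurableEquiv_injective
  rw [hmp.map_eq, ← hjoint, AEMeasurable.map_map_of_aemeasurable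
    (MeasurableEquiv.measurable _).aemeasurable
    (aemeasurable_pi_lambda _ fun i => (hF i).prodMk (hG i))]
  rfl

omit [IsProbabilityMeasure μ] in
/-- Two pre-Brownian motions have the same law along sequences of times. -/
lemma ProbabilityTheory.IsPreBrownianReal.identDistrib_comp {B : ℝ≥0 → Ω → ℝ}
    {B' : ℝ≥0 → Ω' → ℝ} (hB : IsPreBrownianReal B μ) (hB' : IsPreBrownianReal B' μ')
    (t : ℕ → ℝ≥0) :
    IdentDistrib (fun ω n => B (t n) ω) (fun ω n => B' (t n) ω) μ μ' where
  aemeasurable_fst := aemeasurable_pi_lambda _ fun n => hB.aemeasurable _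
  aemeasurable_snd := aemeasurable_pi_lambda _ fun n => hB'.aemeasurable _
  map_eq := by
    classical
    have h1 := isProjectiveLimit_map (P := μ) (X := fun n => B (t n))
      (aemeasurable_pi_lambda _ fun n => hB.aemeasurable _)
    have h2 := isProjectiveLimit_map (P := μ') (X := fun n => B' (t n))
      (aemeasurable_pi_lambda _ fun n => hB'.aemeasurable _)
    have hfam : (fun I : Finset ℕ => μ.map (fun ω => I.restrict (fun n => B (t n) ω)))
        = fun I : Finset ℕ => μ'.map (fun ω => I.restrict (fun n => B' (t n) ω)) := by
      funext I
      -- The times t n may repeat, so the finite-dimensional law is taken over the set of distinct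
      -- times and then copied to the indices by φ.
      set J : Finset ℝ≥0 := I.image t
      set φ : (J → ℝ) → (I → ℝ) := fun x n => x ⟨t n, Finset.mem_image_of_mem t n.2⟩ with hφ
      have hφm : Measurable φ := measurable_pi_lambda _ fun n => measurable_pi_apply _
      have e1 : μ.map (fun ω => I.restrict (fun n => B (t n) ω))
          = (μ.map (fun ω => J.restrict (B · ω))).map φ :=
        (AEMeasurable.map_map_of_aemeasurable hφm.aemeasurable (hB.hasLaw J).aemeasurable).symm
      have e2 : μ'.map (fun ω => I.restrict (fun n => B' (t n) ω))
          = (μ'.map (fun ω => J.restrict (B' · ω))).map φ :=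
        (AEMeasurable.map_map_of_aemeasurable hφm.aemeasurable (hB'.hasLaw J).aemeasurable).symm
      rw [e1, e2, (hB.hasLaw J).map_eq, (hB'.hasLaw J).map_eq]
    rw [hfam] at h1
    have : ∀ I : Finset ℕ, IsFiniteMeasure
        (μ'.map (fun ω => I.restrict (fun n => B' (t n) ω))) := fun I => inferInstance
    exact h1.unique h2

/-- Concatenation of two independent pre-Brownian motions. -/
lemma ProbabilityTheory.IsPreBrownianReal.concat {W₁ W₂ : ℝ≥0 → Ω → ℝ}
    (hinc : IsPreBrownianReal W₁ μ) (hini : IsPreBrownianReal W₂ μ)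
    (hind : IndepFun (fun ω t => W₁ t ω) (fun ω t => W₂ t ω) μ) (c : ℝ≥0) :
    IsPreBrownianReal (fun t ω => W₂ (min t c) ω + W₁ (t - c) ω) μ := by
  have g₁ := hinc.isGaussianProcess.comp_right (fun t : ℝ≥0 => t - c)
  have g₂ := hini.isGaussianProcess.comp_right (fun t : ℝ≥0 => min t c)
  have m₁ : ∀ t, MemLp (W₁ t) 2 μ := fun t =>
    (hinc.isGaussianProcess.hasGaussianLaw_eval t).memLp_two
  have m₂ : ∀ t, MemLp (W₂ t) 2 μ := fun t =>
    (hini.isGaussianProcess.hasGaussianLaw_eval t).memLp_two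
  refine IsGaussianProcess.isPreBrownianReal_of_covariance ⟨fun I => ?_⟩ (fun t => ?_)
    fun s t hst => ?_
  · have hI : IndepFun (fun ω => I.restrict fun t => W₂ (min t c) ω)
        (fun ω => I.restrict fun t => W₁ (t - c) ω) μ :=
      (hind.symm.comp (φ := fun x : ℝ≥0 → ℝ => I.restrict fun t => x (min t c))
        (ψ := fun x : ℝ≥0 → ℝ => I.restrict fun t => x (t - c))
        (measurable_pi_lambda _ fun _ => measurable_pi_apply _)
        (measurable_pi_lambda _ fun _ => measurable_pi_apply _))
    exact (hI.hasGaussianLaw (g₂.hasGaussianLaw I) (g₁.hasGaussianLaw I)).add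
  · rw [integral_add (hini.integrable_eval _) (hinc.integrable_eval _), hinc.integral_eval,
      hini.integral_eval, add_zero]
  · have hcov : ∀ s t, cov[W₁ s, W₂ t; μ] = 0 := fun s t =>
      (hind.comp (measurable_pi_apply s) (measurable_pi_apply t)).covariance_eq_zero (m₁ s) (m₂ t)
    change cov[W₂ (min s c) + W₁ (s - c), W₂ (min t c) + W₁ (t - c); μ] = s
    rw [covariance_add_left (m₂ _) (m₁ _) ((m₂ _).add (m₁ _)),
      covariance_add_right (m₂ _) (m₂ _) (m₁ _), covariance_add_right (m₁ _) (m₂ _) (m₁ _),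
      hinc.covariance_eval, hini.covariance_eval, hcov, covariance_comm, hcov]
    rw [min_eq_left (min_le_min_right c hst), min_eq_left (tsub_le_tsub_right hst c)]
    -- Subtraction is truncated: W₂ contributes the variance up to c and W₁ the part of s beyond c.
    have : min s c + (s - c) = s := by
      rcases le_total s c with h | h
      · rw [min_eq_left h, tsub_eq_zero_of_le h, add_zero]
      · rw [min_eq_right h, add_tsub_cancel_of_le h]
    rw [add_zero, zero_add, ← NNReal.coe_add, this]

variable {p : ℕ}

/-- The path of `W₂` up to time `c`, continued with the increments given by `W₁`. -/
noncomputable def concatPath (W₁ W₂ : ℝ≥0 → Ω → Fin p → ℝ) (c : ℝ≥0) (t : ℝ≥0) (ω : Ω) :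
    Fin p → ℝ :=
  W₂ (min t c) ω + W₁ (t - c) ω

/-- The Brownian rescaling `t ↦ c ^ (-1 / 2) W (c t)`. -/
noncomputable def scaledPath (W : ℝ≥0 → Ω → Fin p → ℝ) (c : ℝ≥0) (t : ℝ≥0) (ω : Ω) :
    Fin p → ℝ :=
  (√(c : ℝ))⁻¹ • W (c * t) ω

lemma isPreBrownianReal_concatPath {W₁ W₂ : ℝ≥0 → Ω → Fin p → ℝ} (h₁ : IsStdBrownian W₁ μ)
    (h₂ : IsStdBrownian W₂ μ) (hind : IndepFun (fun ω t => W₁ t ω) (fun ω t => W₂ t ω) μ)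
    (c : ℝ≥0) (i : Fin p) : IsPreBrownianReal (fun t ω => concatPath W₁ W₂ c t ω i) μ := by
  have hm : Measurable fun (x : ℝ≥0 → Fin p → ℝ) (t : ℝ≥0) => x t i :=
    measurable_pi_lambda _ fun t => (measurable_pi_apply i).comp (measurable_pi_apply t)
  exact (h₁.coord i).toIsPreBrownianReal.concat (h₂.coord i).toIsPreBrownianReal
    (hind.comp hm hm) c

omit [IsProbabilityMeasure μ] in
lemma isPreBrownianReal_scaledPath {W : ℝ≥0 → Ω → Fin p → ℝ} (h : IsStdBrownian W μ)
    {c : ℝ≥0} (hc : c ≠ 0) (i : Fin p) :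
    IsPreBrownianReal (fun t ω => scaledPath W c t ω i) μ :=
  (h.coord i).toIsPreBrownianReal.smul hc

lemma iIndepFun_concatPath {W₁ W₂ : ℝ≥0 → Ω → Fin p → ℝ} (h₁ : IsStdBrownian W₁ μ)
    (h₂ : IsStdBrownian W₂ μ) (hind : IndepFun (fun ω t => W₁ t ω) (fun ω t => W₂ t ω) μ)
    (c : ℝ≥0) : iIndepFun (fun i ω (n : ℕ) => concatPath W₁ W₂ c n ω i) μ := by
  have hm : ∀ t : ℕ → ℝ≥0, Measurable fun (x : ℝ≥0 → ℝ) (n : ℕ) => x (t n) := fun t =>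
    measurable_pi_lambda _ fun n => measurable_pi_apply _
  have hm' : ∀ t : ℕ → ℝ≥0,
      Measurable fun (x : ℝ≥0 → Fin p → ℝ) (i : Fin p) (n : ℕ) => x (t n) i := fun t =>
    measurable_pi_lambda _ fun i => measurable_pi_lambda _ fun n =>
      (measurable_pi_apply i).comp (measurable_pi_apply _)
  have key := iIndepFun.prodMk_of_indepFun (μ := μ)
    (F := fun (i : Fin p) ω (n : ℕ) => W₁ ((n : ℝ≥0) - c) ω i)
    (G := fun (i : Fin p) ω (n : ℕ) => W₂ (min (n : ℝ≥0) c) ω i)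
    (fun i => aemeasurable_pi_lambda _ fun n => (h₁.coord i).aemeasurable _)
    (fun i => aemeasurable_pi_lambda _ fun n => (h₂.coord i).aemeasurable _)
    (h₁.indep.comp _ fun _ => hm fun n => (n : ℝ≥0) - c)
    (h₂.indep.comp _ fun _ => hm fun n => min (n : ℝ≥0) c)
    (hind.comp (hm' fun n => (n : ℝ≥0) - c) (hm' fun n => min (n : ℝ≥0) c))
  exact key.comp (fun _ (q : (ℕ → ℝ) × (ℕ → ℝ)) n => q.2 n + q.1 n) fun _ =>
    measurable_pi_lambda _ fun n => ((measurable_pi_apply n).comp measurable_snd).add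
      ((measurable_pi_apply n).comp measurable_fst)

omit [IsProbabilityMeasure μ] in
lemma iIndepFun_scaledPath {W : ℝ≥0 → Ω → Fin p → ℝ} (h : IsStdBrownian W μ) (c : ℝ≥0) :
    iIndepFun (fun i ω (n : ℕ) => scaledPath W c n ω i) μ :=
  h.indep.comp (fun _ (x : ℝ≥0 → ℝ) (n : ℕ) => (√(c : ℝ))⁻¹ * x (c * n)) fun _ =>
    measurable_pi_lambda _ fun _ => (measurable_pi_apply _).const_mul _

-- On integer times both sides have independent coordinates, each with the law of a standard
-- Brownian motion. Hence the gluing time c and the scale c' need not be related.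
omit [IsProbabilityMeasure μ'] in
lemma identDistrib_scaledPath_concatPath {W : ℝ≥0 → Ω' → Fin p → ℝ} (h : IsStdBrownian W μ')
    {W₁ W₂ : ℝ≥0 → Ω → Fin p → ℝ} (h₁ : IsStdBrownian W₁ μ)
    (h₂ : IsStdBrownian W₂ μ) (hind : IndepFun (fun ω t => W₁ t ω) (fun ω t => W₂ t ω) μ)
    (c : ℝ≥0) {c' : ℝ≥0} (hc' : c' ≠ 0) :
    IdentDistrib (fun ω (i : Fin p) (n : ℕ) => scaledPath W c' n ω i)
      (fun ω (i : Fin p) (n : ℕ) => concatPath W₁ W₂ c n ω i) μ' μ :=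
  IdentDistrib.pi (fun i => (isPreBrownianReal_scaledPath h hc' i).identDistrib_comp
    (isPreBrownianReal_concatPath h₁ h₂ hind c i) fun n => (n : ℝ≥0))
    (iIndepFun_scaledPath h c') (iIndepFun_concatPath h₁ h₂ hind c)

end BrownianLaw

/-! ### The limiting functional as a limit of grid suprema. -/

section LimitSup

variable {p : ℕ}

lemma wnorm_one_le (y : Fin p → ℝ) : wnorm 1 y ≤ ‖y‖ := by
  unfold wnorm
  rw [Matrix.one_mulVec]
  refine Real.sqrt_le_iff.2 ⟨norm_nonneg _, ?_⟩
  refine div_le_of_le_mul₀ (Nat.cast_nonneg _) (sq_nonneg _) ?_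
  unfold dotProduct
  refine (Finset.sum_le_card_nsmul _ _ (‖y‖ ^ 2) fun i _ => ?_).trans ?_
  · rw [← sq, ← sq_abs]
    exact pow_le_pow_left₀ (abs_nonneg _) (norm_le_pi_norm y i) 2
  · simp [mul_comm]

/-- The functional of a path whose supremum is `limitSup`. -/
noncomputable def limitFun (η : ℝ) (w : ℝ≥0 → Fin p → ℝ) (s t : ℝ≥0) : ℝ :=
  (t : ℝ) ^ (-(3 / 2) - η : ℝ) * wnorm 1 ((t : ℝ) • w s - (s : ℝ) • w t)

/-- Brownian scaling by √m makes the powers of m cancel, leaving a function of s = j/m and t = k/m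
only. -/
lemma wnorm_cusum_scaled {η : ℝ} {m j k : ℕ} (hm : 1 ≤ m) (hk : m ≤ k) (w : ℝ≥0 → Fin p → ℝ) :
    wnorm 1 (cusum η m (fun n => (√((m : ℝ≥0)⁻¹ : ℝ≥0))⁻¹ • w ((m : ℝ≥0)⁻¹ * n)) j k) =
      limitFun η w ((m : ℝ≥0)⁻¹ * j) ((m : ℝ≥0)⁻¹ * k) := by
  have hm0 : (0 : ℝ) < m := by exact_mod_cast hm
  have hk0 : (0 : ℝ) < k := by exact_mod_cast hm.trans hk
  have hsq : (√((m : ℝ≥0)⁻¹ : ℝ≥0))⁻¹ = (m : ℝ) ^ (1 / 2 : ℝ) := by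
    rw [NNReal.coe_inv, NNReal.coe_natCast, Real.sqrt_inv, inv_inv, Real.sqrt_eq_rpow]
  unfold limitFun
  rw [← wnorm_smul _ (by positivity)]
  congr 1
  unfold cusum
  simp only [NNReal.coe_mul, NNReal.coe_inv, NNReal.coe_natCast] at hsq ⊢
  rw [hsq]
  have e : ((m : ℝ) / k) ^ (3 / 2 + η : ℝ) / (m : ℝ) ^ (3 / 2 : ℝ) * (m : ℝ) ^ (1 / 2 : ℝ)
      = ((m : ℝ)⁻¹ * k) ^ (-(3 / 2) - η : ℝ) * (m : ℝ)⁻¹ := by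
    have h1 : ((m : ℝ)⁻¹ * k) ^ (-(3 / 2) - η : ℝ) = ((m : ℝ) / k) ^ (3 / 2 + η : ℝ) := by
      rw [show (m : ℝ)⁻¹ * k = ((m : ℝ) / k)⁻¹ by field_simp, Real.inv_rpow (by positivity),
        ← Real.rpow_neg (by positivity)]
      congr 1
      ring
    rw [h1, show (3 / 2 : ℝ) = 1 + 1 / 2 by norm_num, Real.rpow_add hm0 1 (1 / 2), Real.rpow_one]
    have := Real.rpow_pos_of_pos hm0 (1 / 2)
    field_simp
  ext i
  simp only [Pi.smul_apply, Pi.sub_apply, smul_eq_mul]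
  linear_combination ((k : ℝ) * w ((m : ℝ≥0)⁻¹ * j) i - (j : ℝ) * w ((m : ℝ≥0)⁻¹ * k) i) * e

lemma tendsto_inv_mul_ceil (s : ℝ≥0) :
    Tendsto (fun m : ℕ => (m : ℝ≥0)⁻¹ * (⌈(m : ℝ≥0) * s⌉₊ : ℝ≥0)) atTop (𝓝 s) := by
  have h := (tendsto_nat_ceil_mul_div_atTop (R := ℝ) s.coe_nonneg).comp tendsto_natCast_atTop_atTop
  rw [← NNReal.tendsto_coe]
  refine h.congr fun m => ?_
  simp only [Function.comp, NNReal.coe_mul, NNReal.coe_inv, NNReal.coe_natCast]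
  rw [div_eq_inv_mul, mul_comm (s : ℝ), ← NNReal.coe_natCast, ← NNReal.coe_mul]
  rfl

lemma ofReal_limitFun_le {η : ℝ} {w : ℝ≥0 → Fin p → ℝ} {s t : ℝ≥0} (hs : 1 ≤ s) (hst : s ≤ t) :
    ENNReal.ofReal (limitFun η w s t) ≤ limitSup η w :=
  le_iSup₂_of_le (f := fun s t : ℝ≥0 => ⨆ (_ : 1 ≤ s) (_ : s ≤ t),
    ENNReal.ofReal (limitFun η w s t)) s t (le_iSup₂_of_le hs hst le_rfl)

/-- Grid points are admissible in the supremum, which gives the upper bound for each m. For the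
lower bound, a nearly optimal pair (s, t) is approximated by the grid points ⌈ms⌉/m and ⌈mt⌉/m. -/
lemma tendsto_triSup_limitSup {η : ℝ} {w : ℝ≥0 → Fin p → ℝ} (hw : Continuous w) :
    Tendsto (fun m : ℕ => triSup m fun j k =>
      wnorm 1 (cusum η m (fun n => (√((m : ℝ≥0)⁻¹ : ℝ≥0))⁻¹ • w ((m : ℝ≥0)⁻¹ * n)) j k))
      atTop (𝓝 (limitSup η w)) := by
  refine tendsto_order.2 ⟨fun c hc => ?_, fun c hc => ?_⟩
  · obtain ⟨s, t, hs, hst, hlt⟩ : ∃ s t : ℝ≥0, 1 ≤ s ∧ s ≤ t ∧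
        c < ENNReal.ofReal (limitFun η w s t) := by
      by_contra! hcon
      exact absurd hc (not_lt.2 (iSup₂_le fun s t => iSup₂_le fun hs hst => hcon s t hs hst))
    -- The functional is 0 on the diagonal and so cannot exceed c there. Strictness makes the two
    -- ceilings differ eventually, as j < k requires.
    have hst' : s < t := by
      refine lt_of_le_of_ne hst fun h => ?_
      subst h
      unfold limitFun wnorm at hlt
      simp at hlt
    have ht0 : 0 < t := (zero_lt_one.trans_le hs).trans_le hst
    have hcont : ContinuousAt (fun q : ℝ≥0 × ℝ≥0 => limitFun η w q.1 q.2) (s, t) := by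
      unfold limitFun
      refine ContinuousAt.mul ?_ ?_
      · exact ContinuousAt.rpow_const (by fun_prop) (Or.inl (by exact_mod_cast ht0.ne'))
      · exact (continuous_wnorm.comp (f := fun q : ℝ≥0 × ℝ≥0 =>
          ((1 : Matrix (Fin p) (Fin p) ℝ), (q.2 : ℝ) • w q.1 - (q.1 : ℝ) • w q.2))
          (by fun_prop)).continuousAt
    have hlim := (ENNReal.continuous_ofReal.continuousAt.comp hcont).tendsto.comp
      ((tendsto_inv_mul_ceil s).prodMk_nhds (tendsto_inv_mul_ceil t))
    have hgap : ∀ᶠ m : ℕ in atTop, ⌈(m : ℝ≥0) * s⌉₊ < ⌈(m : ℝ≥0) * t⌉₊ := by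
      filter_upwards [((tendsto_inv_mul_ceil s).eventually_lt (tendsto_inv_mul_ceil t) hst')]
        with m hm
      exact_mod_cast lt_of_mul_lt_mul_left hm zero_le
    filter_upwards [hlim.eventually (lt_mem_nhds hlt), hgap, eventually_ge_atTop 1]
      with m h1 h2 hm
    have hj : m ≤ ⌈(m : ℝ≥0) * s⌉₊ := by
      have : (m : ℝ≥0) ≤ m * s := le_mul_of_one_le_right zero_le hs
      exact_mod_cast this.trans (Nat.le_ceil _)
    refine lt_of_lt_of_le h1 ?_
    have := le_triSup (f := fun j k =>
      wnorm 1 (cusum η m (fun n => (√((m : ℝ≥0)⁻¹ : ℝ≥0))⁻¹ • w ((m : ℝ≥0)⁻¹ * n)) j k)) hj h2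
    rwa [wnorm_cusum_scaled hm (hj.trans h2.le)] at this
  · filter_upwards [eventually_ge_atTop 1] with m hm
    refine lt_of_le_of_lt (triSup_le fun j k hj hk => ?_) hc
    rw [wnorm_cusum_scaled hm (hj.trans hk.le)]
    have hm0 : (0 : ℝ≥0) < m := by exact_mod_cast hm
    have h1 : 1 ≤ (m : ℝ≥0)⁻¹ * j := by
      rw [← div_eq_inv_mul, one_le_div hm0]
      exact_mod_cast hj
    have h2 : (m : ℝ≥0)⁻¹ * j ≤ (m : ℝ≥0)⁻¹ * k := by
      gcongr
    exact ofReal_limitFun_le h1 h2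

variable {Ω : Type*} [MeasurableSpace Ω] {μ : Measure Ω}

lemma IsStdBrownian.ae_tendsto_limitSup {W : ℝ≥0 → Ω → Fin p → ℝ} (h : IsStdBrownian W μ)
    (η : ℝ) : ∀ᵐ ω ∂μ, Tendsto (fun m : ℕ => triSup m fun j k =>
      wnorm 1 (cusum η m (fun n => scaledPath W (m : ℝ≥0)⁻¹ n ω) j k)) atTop
      (𝓝 (limitSup η fun t => W t ω)) := by
  filter_upwards [ae_all_iff.2 fun i => (h.coord i).cont] with ω hω
  have hc : Continuous fun t => W t ω := continuous_pi hω
  have key := tendsto_triSup_limitSup (η := η) (w := fun t => W t ω) hc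
  exact key

/-- Where `limitSup` is infinite the grid suprema tend to ∞, so they eventually exceed any r. The
growth bound, uniform in m, gives this event probability at most of order r^(-2), and r is
arbitrary. -/
lemma IsStdBrownian.ae_limitSup_lt_top [IsProbabilityMeasure μ] {W : ℝ≥0 → Ω → Fin p → ℝ} (h : IsStdBrownian W μ)
    {η : ℝ} (hη : 0 < η) : ∀ᵐ ω ∂μ, limitSup η (fun t => W t ω) < ∞ := by
  set G : ℕ → Ω → ℝ≥0∞ := fun m ω => triSup m fun j k =>
      ‖cusum η m (fun n => scaledPath W (m : ℝ≥0)⁻¹ n ω) j k‖ with hG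
  have hbound : ∀ r : ℝ, 0 < r → μ (⋃ N : ℕ, {ω | ∀ m, N + 1 ≤ m → ENNReal.ofReal r ≤ G m ω}) ≤
      p * ENNReal.ofReal (growthConst η / (r / 4) ^ 2) := by
    intro r hr
    -- The union increases, so its measure is a supremum of measures of sets, each contained in a
    -- single event at m = N + 1.
    have hmono : Monotone fun N : ℕ => {ω | ∀ m, N + 1 ≤ m → ENNReal.ofReal r ≤ G m ω} :=
      fun N N' hN ω hω m hm => hω m (by omega)
    rw [hmono.measure_iUnion]
    refine iSup_le fun N => le_trans (measure_mono ?_)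
      (measure_le_triSup_cusum_le (m := N + 1) (fun i => isPreBrownianReal_scaledPath h
        (inv_ne_zero (Nat.cast_ne_zero.2 (Nat.succ_ne_zero N))) i) hη (by omega) hr)
    exact fun ω hω => hω (N + 1) le_rfl
  have hlim := tendsto_growthConst_div p η
  have hnull : μ {ω | Tendsto (fun m => G m ω) atTop (𝓝 ∞)} = 0 := by
    refine le_antisymm (ge_of_tendsto hlim ?_) zero_le
    filter_upwards [eventually_gt_atTop 0] with r hr
    refine (measure_mono fun ω hω => ?_).trans (hbound r hr)
    obtain ⟨N, hN⟩ := eventually_atTop.1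
      ((show Tendsto (fun m => G m ω) atTop (𝓝 ∞) from hω).eventually
        (lt_mem_nhds (ENNReal.ofReal_lt_top (r := r))))
    exact Set.mem_iUnion.2 ⟨N, fun m hm => (hN m (by omega)).le⟩
  filter_upwards [h.ae_tendsto_limitSup η, (measure_eq_zero_iff_ae_notMem.1 hnull)] with ω h1 h2
  refine lt_top_iff_ne_top.2 fun htop => h2 ?_
  rw [htop] at h1
  refine tendsto_nhds_top_mono' h1 fun m => triSup_le fun j k hj hk => ?_
  exact (ENNReal.ofReal_le_ofReal (wnorm_one_le _)).trans
    (le_triSup (f := fun j k => ‖cusum η m (fun n => scaledPath W (m : ℝ≥0)⁻¹ n ω) j k‖) hj hk)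

end LimitSup

/-! ### The weighted detector as a maximum of CUSUM norms. -/

section Detector

variable {d p : ℕ}

/-- Partial sums of the indicator vectors of the path `x` at the points `P`. -/
noncomputable def indSum (P : Fin p → Fin d → ℝ) (x : ℕ → Fin d → ℝ) (n : ℕ) : Fin p → ℝ :=
  ∑ i ∈ Finset.range n, indVec P (x i)

variable {est : (m : ℕ) → (Fin m → Fin p → ℝ) → Matrix (Fin p) (Fin p) ℝ}
  {x : ℕ → Fin d → ℝ} {P : Fin p → Fin d → ℝ} {m k : ℕ} {η : ℝ}

lemma mul_empDF (n : ℕ) (i : Fin p) : (n : ℝ) * empDF x 0 n (P i) = indSum P x n i := by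
  unfold empDF indSum indVec
  rcases Nat.eq_zero_or_pos n with rfl | hn
  · simp
  · have : (n : ℝ) ≠ 0 := by exact_mod_cast hn.ne'
    rw [Nat.cast_zero, sub_zero, mul_div_cancel₀ _ this, Finset.sum_apply, Finset.range_eq_Ico]

lemma mul_empDF_sub {j : ℕ} (hj : j < k) (i : Fin p) :
    ((k : ℝ) - j) * empDF x j k (P i) = indSum P x k i - indSum P x j i := by
  have : ((k : ℝ) - j) ≠ 0 := sub_ne_zero.2 (by exact_mod_cast hj.ne')
  unfold empDF indSum indVec
  rw [mul_div_cancel₀ _ this, Finset.sum_apply, Finset.sum_apply,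
    ← Finset.sum_Ico_eq_sub _ hj.le]

/-- The algebra is j (k - j) (S_j/j - (S_k - S_j)/(k - j)) = k S_j - j S_k, with the nonnegative
weights moved inside the norm. -/
lemma weight_mul_detector (hm : 1 ≤ m) :
    ((m : ℝ) / k) ^ (3 / 2 + η : ℝ) * detector est x P m k = ⨆ j : Finset.Ico m k,
      wnorm (est m fun i : Fin m => indVec P (x i))⁻¹ (cusum η m (indSum P x) j k) := by
  unfold detector
  rw [Real.mul_iSup_of_nonneg (by positivity)]
  congr 1
  funext ⟨j, hj⟩
  obtain ⟨hmj, hjk⟩ := Finset.mem_Ico.1 hj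
  have hj0 : (j : ℝ) ≠ 0 := by exact_mod_cast (Nat.pos_of_ne_zero (by omega)).ne'
  have hjk' : (0 : ℝ) ≤ k - j := sub_nonneg.2 (by exact_mod_cast hjk.le)
  rw [← mul_assoc, ← wnorm_smul _ (by positivity)]
  congr 1
  unfold cusum
  ext i
  simp only [Pi.smul_apply, Pi.sub_apply, smul_eq_mul]
  rw [← mul_empDF j i, eq_add_of_sub_eq' (mul_empDF_sub (x := x) (P := P) hjk i).symm,
    ← mul_empDF j i]
  ring

lemma abs_weight_mul_detector_sub_le {est' : (m : ℕ) → (Fin m → Fin p → ℝ) →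
      Matrix (Fin p) (Fin p) ℝ} {P' : Fin p → Fin d → ℝ} (hm : 1 ≤ m) (hk : m < k) :
    ENNReal.ofReal (((m : ℝ) / k) ^ (3 / 2 + η : ℝ) *
      |detector est' x P' m k - detector est x P m k|) ≤
    triSup m fun j k =>
      |wnorm (est' m fun i : Fin m => indVec P' (x i))⁻¹ (cusum η m (indSum P' x) j k) -
        wnorm (est m fun i : Fin m => indVec P (x i))⁻¹ (cusum η m (indSum P x) j k)| := by
  have hw : (0 : ℝ) ≤ ((m : ℝ) / k) ^ (3 / 2 + η : ℝ) := by positivity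
  rw [← abs_of_nonneg hw, ← abs_mul, mul_sub, weight_mul_detector hm, weight_mul_detector hm]
  have : Nonempty (Finset.Ico m k) := ⟨⟨m, Finset.mem_Ico.2 ⟨le_rfl, hk⟩⟩⟩
  -- A difference of two maxima is at most the difference of the values at a maximizer of the first.
  have aux : ∀ f g : Finset.Ico m k → ℝ, ∃ j, (⨆ j, f j) - ⨆ j, g j ≤ |f j - g j| := by
    intro f g
    obtain ⟨j, hj⟩ := exists_eq_ciSup_of_finite (f := f)
    refine ⟨j, ?_⟩
    rw [← hj]
    exact (sub_le_sub_left (le_ciSup (Set.finite_range g).bddAbove j) _).trans (le_abs_self _)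
  rcases abs_cases ((⨆ j : Finset.Ico m k, wnorm (est' m fun i : Fin m => indVec P' (x i))⁻¹
      (cusum η m (indSum P' x) j k)) - ⨆ j : Finset.Ico m k,
      wnorm (est m fun i : Fin m => indVec P (x i))⁻¹ (cusum η m (indSum P x) j k))
    with ⟨h, -⟩ | ⟨h, -⟩
  · obtain ⟨⟨j, hj⟩, hle⟩ := aux (fun j => wnorm (est' m fun i : Fin m => indVec P' (x i))⁻¹
      (cusum η m (indSum P' x) j k)) fun j =>
      wnorm (est m fun i : Fin m => indVec P (x i))⁻¹ (cusum η m (indSum P x) j k)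
    obtain ⟨hmj, hjk⟩ := Finset.mem_Ico.1 hj
    rw [h]
    exact (ENNReal.ofReal_le_ofReal hle).trans (le_triSup (f := fun j k =>
      |wnorm (est' m fun i : Fin m => indVec P' (x i))⁻¹ (cusum η m (indSum P' x) j k) -
        wnorm (est m fun i : Fin m => indVec P (x i))⁻¹ (cusum η m (indSum P x) j k)|) hmj hjk)
  · obtain ⟨⟨j, hj⟩, hle⟩ := aux (fun j => wnorm (est m fun i : Fin m => indVec P (x i))⁻¹
      (cusum η m (indSum P x) j k)) fun j =>
      wnorm (est' m fun i : Fin m => indVec P' (x i))⁻¹ (cusum η m (indSum P' x) j k)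
    obtain ⟨hmj, hjk⟩ := Finset.mem_Ico.1 hj
    rw [h, neg_sub]
    rw [abs_sub_comm] at hle
    exact (ENNReal.ofReal_le_ofReal hle).trans (le_triSup (f := fun j k =>
      |wnorm (est' m fun i : Fin m => indVec P' (x i))⁻¹ (cusum η m (indSum P' x) j k) -
        wnorm (est m fun i : Fin m => indVec P (x i))⁻¹ (cusum η m (indSum P x) j k)|) hmj hjk)

lemma iSup_weight_mul_detector (hm : 1 ≤ m) :
    ⨆ (k : ℕ) (_ : m < k), ENNReal.ofReal (((m : ℝ) / k) ^ (3 / 2 + η : ℝ) *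
      detector est x P m k) = triSup m fun j k =>
        wnorm (est m fun i : Fin m => indVec P (x i))⁻¹ (cusum η m (indSum P x) j k) := by
  refine le_antisymm (iSup₂_le fun k hk => ?_) (triSup_le fun j k hj hk => ?_)
  · rw [weight_mul_detector hm]
    have : Nonempty (Finset.Ico m k) := ⟨⟨m, Finset.mem_Ico.2 ⟨le_rfl, hk⟩⟩⟩
    obtain ⟨⟨j, hj⟩, hj'⟩ := exists_eq_ciSup_of_finite (f := fun j : Finset.Ico m k =>
      wnorm (est m fun i : Fin m => indVec P (x i))⁻¹ (cusum η m (indSum P x) j k))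
    obtain ⟨hmj, hjk⟩ := Finset.mem_Ico.1 hj
    rw [← hj']
    exact le_triSup (f := fun j k =>
      wnorm (est m fun i : Fin m => indVec P (x i))⁻¹ (cusum η m (indSum P x) j k)) hmj hjk
  · refine le_iSup₂_of_le k (hj.trans_lt hk) (ENNReal.ofReal_le_ofReal ?_)
    rw [weight_mul_detector hm]
    exact le_ciSup (f := fun j : Finset.Ico m k =>
      wnorm (est m fun i : Fin m => indVec P (x i))⁻¹ (cusum η m (indSum P x) j k))
      (Set.finite_range _).bddAbove ⟨j, Finset.mem_Ico.2 ⟨hj, hk⟩⟩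

end Detector

/-! ### Measurability of empirical quantiles and of the detector. -/

section Measurability

variable {Ω : Type*} [MeasurableSpace Ω] {d p : ℕ}

lemma measurable_indVec {P : Ω → Fin p → Fin d → ℝ} {Z : Ω → Fin d → ℝ}
    (hP : ∀ i, Measurable fun ω => P ω i) (hZ : Measurable Z) :
    Measurable fun ω => indVec (P ω) (Z ω) := by
  refine measurable_pi_lambda _ fun i => ?_
  have hs : MeasurableSet {ω | Z ω ≤ P ω i} := measurableSet_le hZ (hP i)
  have : (fun ω => indVec (P ω) (Z ω) i) = {ω | Z ω ≤ P ω i}.indicator 1 := by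
    funext ω
    rfl
  rw [this]
  exact measurable_one.indicator hs

lemma measurable_empDF {α : Type*} [MeasurableSpace α] [TopologicalSpace α] [PartialOrder α]
    [OrderClosedTopology α] [SecondCountableTopology α] [OpensMeasurableSpace α]
    {X : ℕ → Ω → α} (hX : ∀ i, Measurable (X i)) {z : Ω → α} (hz : Measurable z) (a b : ℕ) :
    Measurable fun ω => empDF (fun n => X n ω) a b (z ω) := by
  unfold empDF
  refine Measurable.div_const (Finset.measurable_sum _ fun i _ => ?_) _
  have : (fun ω => (Set.Iic (z ω)).indicator (1 : α → ℝ) (X i ω))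
      = {ω | X i ω ≤ z ω}.indicator 1 := by
    funext ω
    rfl
  rw [this]
  exact measurable_one.indicator (measurableSet_le (hX i) hz)

lemma empDF_mono {x : ℕ → ℝ} (n : ℕ) : Monotone fun z => empDF x 0 n z := by
  intro z z' h
  unfold empDF
  refine div_le_div_of_nonneg_right (Finset.sum_le_sum fun i _ => ?_) (by simp)
  exact Set.indicator_le_indicator_of_subset (Set.Iic_subset_Iic.2 h) (fun _ => zero_le_one) _

/-- Monotonicity allows rational witnesses, hence countable unions. That y lies in (0, 1) and n ≥ 1
makes the set in the infimum nonempty and bounded below, so that `sInf` is a true infimum. -/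
lemma quantile_empDF_lt_iff {x : ℕ → ℝ} {n : ℕ} (hn : 1 ≤ n) {y : ℝ} (hy : y ∈ Set.Ioo (0 : ℝ) 1)
    (c : ℝ) : quantile (empDF x 0 n) y < c ↔ ∃ q : ℚ, (q : ℝ) < c ∧ y ≤ empDF x 0 n q := by
  have hn0 : (0 : ℝ) < n := by exact_mod_cast hn
  have habs : ∀ i ∈ Finset.Ico 0 n, |x i| ≤ ∑ i ∈ Finset.Ico 0 n, |x i| := fun i hi =>
    Finset.single_le_sum (f := fun i => |x i|) (fun i _ => abs_nonneg _) hi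
  have hne : {z : ℝ | y ≤ empDF x 0 n z}.Nonempty := by
    refine ⟨∑ i ∈ Finset.Ico 0 n, |x i|, ?_⟩
    have : empDF x 0 n (∑ i ∈ Finset.Ico 0 n, |x i|) = 1 := by
      unfold empDF
      rw [Finset.sum_congr rfl (g := fun _ => (1 : ℝ)) fun i hi => Set.indicator_of_mem
        (Set.mem_Iic.2 ((le_abs_self _).trans (habs i hi))) _]
      simp [hn0.ne']
    exact (this ▸ hy.2.le : y ≤ empDF x 0 n _)
  have hbdd : BddBelow {z : ℝ | y ≤ empDF x 0 n z} := by
    refine ⟨-∑ i ∈ Finset.Ico 0 n, |x i|, fun z hz => ?_⟩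
    by_contra hcon
    have : empDF x 0 n z = 0 := by
      unfold empDF
      rw [Finset.sum_congr rfl (g := fun _ => (0 : ℝ)) fun i hi => Set.indicator_of_notMem ?_ _]
      · simp
      · have h1 := habs i hi
        have h2 := neg_abs_le (x i)
        simp only [Set.mem_Iic, not_le] at hcon ⊢
        linarith
    exact absurd (show y ≤ empDF x 0 n z from hz) (by rw [this]; exact not_le.2 hy.1)
  unfold quantile
  rw [csInf_lt_iff hbdd hne]
  constructor
  · rintro ⟨z, hz, hzc⟩
    obtain ⟨q, hq1, hq2⟩ := exists_rat_btwn hzc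
    exact ⟨q, hq2, le_trans hz (empDF_mono n hq1.le)⟩
  · rintro ⟨q, hq1, hq2⟩
    exact ⟨q, hq2, hq1⟩

lemma measurable_dataPoints {X : ℕ → Ω → Fin d → ℝ} (hX : ∀ i, Measurable (X i))
    {π : Fin p → Fin d → ℝ} (hπ : ∀ i l, π i l ∈ Set.Ioo (0 : ℝ) 1) (m : ℕ) (i : Fin p) :
    Measurable fun ω => dataPoints (fun n => X n ω) m π i := by
  refine measurable_pi_lambda _ fun l => ?_
  have hXl : ∀ n, Measurable fun ω => X n ω l := fun n => (measurable_pi_apply l).comp (hX n)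
  unfold dataPoints
  rcases Nat.eq_zero_or_pos m with rfl | hm
  · have : ∀ ω, empDF (fun n => X n ω l) 0 0 = 0 := fun ω => by
      funext z
      simp [empDF]
    simp_rw [this]
    exact measurable_const
  · refine measurable_of_Iio fun c => ?_
    have : (fun ω => quantile (empDF (fun n => X n ω l) 0 m) (π i l)) ⁻¹' Set.Iio c =
        ⋃ q : ℚ, ⋃ _ : (q : ℝ) < c, {ω | π i l ≤ empDF (fun n => X n ω l) 0 m (q : ℝ)} := by
      ext ω
      simp only [Set.mem_preimage, Set.mem_Iio, quantile_empDF_lt_iff hm (hπ i l),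
        Set.mem_iUnion, Set.mem_ofPred_eq, exists_prop]
    rw [this]
    exact .iUnion fun q => .iUnion fun _ =>
      measurableSet_le measurable_const (measurable_empDF hXl measurable_const 0 m)

lemma measurable_detector {X : ℕ → Ω → Fin d → ℝ} (hX : ∀ i, Measurable (X i))
    {P : Ω → Fin p → Fin d → ℝ} (hP : ∀ i, Measurable fun ω => P ω i)
    {est : (m : ℕ) → (Fin m → Fin p → ℝ) → Matrix (Fin p) (Fin p) ℝ}
    (hest : ∀ m a b, Measurable (fun y => est m y a b)) (m k : ℕ) :
    Measurable fun ω => detector est (fun n => X n ω) (P ω) m k := by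
  unfold detector
  refine .iSup fun j => Measurable.const_mul (measurable_wnorm_inv (fun a b => ?_) ?_) _
  · exact (hest m a b).comp (measurable_pi_lambda _ fun i => measurable_indVec hP (hX i))
  · exact measurable_pi_lambda _ fun i =>
      (measurable_empDF hX (hP i) _ _).sub (measurable_empDF hX (hP i) _ _)

end Measurability

/-! ### Negligible errors: estimated points and Brownian approximation. -/

section Closeness

lemma pi_norm_le_sum {p : ℕ} (y : Fin p → ℝ) : ‖y‖ ≤ ∑ i, |y i| :=
  (pi_norm_le_iff_of_nonneg (Finset.sum_nonneg fun _ _ => abs_nonneg _)).2 fun i =>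
    Finset.single_le_sum (f := fun i => |y i|) (fun _ _ => abs_nonneg _) (Finset.mem_univ i)

/-- After removal of the random drift n (F(𝒳) - F(x)), the difference of partial sums is the process
in `PointsCond`. The factor 2 there accounts for the terms at j and at k. -/
lemma isLittleOP_cusum_dataPoints {Ω : Type*} [MeasurableSpace Ω] {μ : Measure Ω} {d p : ℕ}
    {X : ℕ → Ω → Fin d → ℝ} {π : Fin p → Fin d → ℝ} (hpts : PointsCond μ X π) {η : ℝ}
    (hη : 0 ≤ η) :
    IsLittleOP μ fun m ω => triSup m fun j k =>
      ‖cusum η m (indSum (dataPoints (fun n => X n ω) m π) fun n => X n ω) j k -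
        cusum η m (indSum (truePoints μ (X 0) π) fun n => X n ω) j k‖ := by
  refine IsLittleOP.mono (IsLittleOP.sum Finset.univ fun i _ => (hpts i).const_mul 2) ?_
  filter_upwards [eventually_ge_atTop 1] with m hm
  refine ae_of_all _ fun ω => triSup_le fun j k hj hk => ?_
  set Q := dataPoints (fun n => X n ω) m π with hQ
  set P := truePoints μ (X 0) π with hP
  set x : ℕ → Fin d → ℝ := fun n => X n ω with hx
  set F := popDF μ (X 0) with hF
  set a : ℕ → Fin p → ℝ := fun n =>
    (indSum Q x n - indSum P x n) - (n : ℝ) • fun i => F (Q i) - F (P i) with ha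
  have ha' : ∀ n i, |a n i| =
      (n : ℝ) * |empDF x 0 n (Q i) - F (Q i) - empDF x 0 n (P i) + F (P i)| := by
    intro n i
    have : a n i = n * (empDF x 0 n (Q i) - F (Q i) - empDF x 0 n (P i) + F (P i)) := by
      simp only [ha, Pi.sub_apply, Pi.smul_apply, smul_eq_mul]
      rw [← mul_empDF, ← mul_empDF]
      ring
    rw [this, abs_mul, Nat.abs_cast]
  have heq : cusum η m (indSum Q x) j k - cusum η m (indSum P x) j k = cusum η m a j k := by
    simp only [ha]
    rw [cusum_sub, cusum_drift, sub_zero, ← cusum_sub]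
  have hbd : ∀ n, 1 ≤ n → n ≤ k → ENNReal.ofReal ((k : ℝ) ^ (-(1 / 2) : ℝ) * ‖a n‖) ≤
      ∑ i : Fin p, ⨆ (k : ℕ) (_ : m < k) (j : ℕ) (_ : 1 ≤ j) (_ : j ≤ k), ENNReal.ofReal
        ((k : ℝ) ^ (-(1 / 2) : ℝ) * ((j : ℝ) *
          |empDF x 0 j (Q i) - F (Q i) - empDF x 0 j (P i) + F (P i)|)) := by
    intro n hn hnk
    calc ENNReal.ofReal ((k : ℝ) ^ (-(1 / 2) : ℝ) * ‖a n‖)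
        ≤ ENNReal.ofReal (∑ i, (k : ℝ) ^ (-(1 / 2) : ℝ) * |a n i|) := by
          rw [← Finset.mul_sum]
          exact ENNReal.ofReal_le_ofReal
            (mul_le_mul_of_nonneg_left (pi_norm_le_sum _) (by positivity))
      _ = ∑ i, ENNReal.ofReal ((k : ℝ) ^ (-(1 / 2) : ℝ) * |a n i|) :=
          ENNReal.ofReal_sum_of_nonneg fun i _ => by positivity
      _ ≤ _ := by
          refine Finset.sum_le_sum fun i _ => ?_
          rw [ha']
          exact le_iSup₂_of_le k (hj.trans_lt hk) <| le_iSup₂_of_le n hn <|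
            le_iSup_of_le hnk le_rfl
  rw [heq]
  refine (ENNReal.ofReal_le_ofReal (norm_cusum_le' hη hm hj hk)).trans ?_
  rw [mul_add, ENNReal.ofReal_add (by positivity) (by positivity)]
  refine (add_le_add (hbd j (hm.trans hj) hk.le) (hbd k (by omega) le_rfl)).trans (le_of_eq ?_)
  rw [← Finset.mul_sum, Nat.cast_ofNat, two_mul]

lemma approxError_add {Ω : Type*} [MeasurableSpace Ω] {p : ℕ} {μ : Measure Ω}
    {Y : ℕ → Ω → Fin p → ℝ} {S : Matrix (Fin p) (Fin p) ℝ} {m n : ℕ} (hmn : m ≤ n)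
    (w₁ w₂ : Fin p → ℝ) (ω : Ω) :
    ‖(∑ i ∈ Finset.range n, Y i ω - matSqrt S *ᵥ (w₂ + w₁)) -
        (n : ℝ) • fun l => ∫ ω', Y 0 ω' l ∂μ‖ ≤
      approxError μ Y S 0 m w₂ ω + approxError μ Y S m n w₁ ω := by
  unfold approxError
  set c : Fin p → ℝ := fun l => ∫ ω', Y 0 ω' l ∂μ
  have hle : ∀ y : Fin p → ℝ, ‖y‖ ≤ ‖WithLp.toLp 2 y‖ := fun y =>
    (pi_norm_le_iff_of_nonneg (norm_nonneg _)).2 fun i => PiLp.norm_apply_le (WithLp.toLp 2 y) i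
  refine le_trans (le_of_eq ?_) ((norm_add_le _ _).trans (add_le_add (hle _) (hle _)))
  congr 1
  rw [Finset.sum_sub_distrib, Finset.sum_sub_distrib, Finset.sum_const, Finset.sum_const,
    Matrix.mulVec_add, Nat.card_Ico, Nat.card_Ico, Finset.range_eq_Ico,
    ← Finset.sum_Ico_consecutive _ (Nat.zero_le m) hmn, ← Nat.cast_smul_eq_nsmul ℝ,
    ← Nat.cast_smul_eq_nsmul ℝ, Nat.cast_sub hmn, sub_smul, Nat.sub_zero]
  abel

/-- With high probability the centred error at every n ≥ m is at most 2 M n^ξ; the CUSUM then has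
norm at most 4 M k^(ξ - 1/2) ≤ 4 M m^(ξ - 1/2), which tends to 0. -/
lemma isLittleOP_cusum_approx {Ω : Type*} [MeasurableSpace Ω] {μ : Measure Ω} {p : ℕ}
    {Y : ℕ → Ω → Fin p → ℝ} {S : Matrix (Fin p) (Fin p) ℝ} {W₁ W₂ : ℕ → ℝ≥0 → Ω → Fin p → ℝ}
    (h₁ : ∀ m, IsStdBrownian (W₁ m) μ) {ξ : ℝ} (hξ0 : 0 < ξ) (hξ : ξ < 1 / 2)
    (hA : IsBigOP μ (fun m ω => ⨆ (k : ℕ) (_ : m < k), ENNReal.ofReal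
      (1 / ((k : ℝ) - (m : ℝ)) ^ ξ *
        approxError μ Y S m k (W₁ m ((k - m : ℕ) : ℝ≥0) ω) ω)))
    (hB : IsBigOP μ (fun m ω => ENNReal.ofReal
      (1 / (m : ℝ) ^ ξ * approxError μ Y S 0 m (W₂ m (m : ℝ≥0) ω) ω)))
    {η : ℝ} (hη : 0 ≤ η) :
    IsLittleOP μ fun m ω => triSup m fun j k =>
      ‖cusum η m (fun n => ∑ i ∈ Finset.range n, Y i ω) j k -
        matSqrt S *ᵥ cusum η m (fun n => concatPath (W₁ m) (W₂ m) m n ω) j k‖ := by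
  intro ε hε
  rw [ENNReal.tendsto_nhds_zero]
  intro r hr
  have hr2 : 0 < r / 2 := ENNReal.div_pos hr.ne' (by simp)
  obtain ⟨M₁, hM₁⟩ := hA _ hr2
  obtain ⟨M₂, hM₂⟩ := hB _ hr2
  set M : ℝ := max M₁ M₂ with hM
  have hM0 : 0 ≤ M := le_max_of_le_left M₁.2
  have hlim : Tendsto (fun m : ℕ => ENNReal.ofReal (4 * M * (m : ℝ) ^ (-(1 / 2 - ξ)))) atTop
      (𝓝 0) := by
    have h1 := ((tendsto_rpow_neg_atTop (show 0 < 1 / 2 - ξ by linarith)).comp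
      tendsto_natCast_atTop_atTop).const_mul (4 * M)
    have h2 := ENNReal.tendsto_ofReal h1
    simpa using h2
  filter_upwards [hM₁, hM₂, hlim.eventually (gt_mem_nhds hε), eventually_ge_atTop 1]
    with m e1 e2 e3 hm
  have hm0 : (0 : ℝ) < m := by exact_mod_cast hm
  have hz : ∀ᵐ ω ∂μ, W₁ m 0 ω = 0 := by
    filter_upwards [ae_all_iff.2 fun i =>
      ((h₁ m).coord i).toIsPreBrownianReal.eval_zero_ae_eq_zero] with ω hω
    exact funext hω
  refine (measure_mono_ae (t := {ω | (M₁ : ℝ≥0∞) < ⨆ (k : ℕ) (_ : m < k), ENNReal.ofReal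
      (1 / ((k : ℝ) - (m : ℝ)) ^ ξ * approxError μ Y S m k (W₁ m ((k - m : ℕ) : ℝ≥0) ω) ω)} ∪
      {ω | (M₂ : ℝ≥0∞) < ENNReal.ofReal
        (1 / (m : ℝ) ^ ξ * approxError μ Y S 0 m (W₂ m (m : ℝ≥0) ω) ω)}) ?_).trans <|
    (measure_union_le _ _).trans <| (add_le_add e1 e2).trans (ENNReal.add_halves r).le
  filter_upwards [hz] with ω hω hmem
  by_contra hcon
  obtain ⟨c1, c2⟩ := not_or.1 hcon
  simp only [Set.mem_ofPred_eq, not_lt] at c1 c2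
  have b2 : approxError μ Y S 0 m (W₂ m (m : ℝ≥0) ω) ω ≤ M * (m : ℝ) ^ ξ := by
    rw [ENNReal.ofReal_le_iff_le_toReal (by simp), ENNReal.coe_toReal, one_div_mul_eq_div,
      div_le_iff₀ (by positivity)] at c2
    exact c2.trans (mul_le_mul_of_nonneg_right (le_max_right _ _) (by positivity))
  have b1 : ∀ n, m ≤ n →
      approxError μ Y S m n (W₁ m ((n - m : ℕ) : ℝ≥0) ω) ω ≤ M * (n : ℝ) ^ ξ := by
    intro n hn
    -- The supremum in the assumption starts at k = m + 1. At n = m the block is empty and W₁ starts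
    -- at 0 almost surely, so the error vanishes.
    rcases hn.eq_or_lt with rfl | hn
    · have : approxError μ Y S m m (W₁ m ((m - m : ℕ) : ℝ≥0) ω) ω = 0 := by
        unfold approxError
        rw [Nat.sub_self, Nat.cast_zero, hω]
        simp
      rw [this]
      positivity
    · have h := (le_iSup₂ (f := fun (k : ℕ) (_ : m < k) => ENNReal.ofReal
        (1 / ((k : ℝ) - (m : ℝ)) ^ ξ *
          approxError μ Y S m k (W₁ m ((k - m : ℕ) : ℝ≥0) ω) ω)) n hn).trans c1
      have hnm : (0 : ℝ) < n - m := sub_pos.2 (by exact_mod_cast hn)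
      rw [ENNReal.ofReal_le_iff_le_toReal (by simp), ENNReal.coe_toReal, one_div_mul_eq_div,
        div_le_iff₀ (by positivity)] at h
      refine h.trans (mul_le_mul (le_max_left _ _) ?_ (by positivity) hM0)
      exact Real.rpow_le_rpow hnm.le (by linarith) hξ0.le
  set R := matSqrt S
  set U : ℕ → Fin p → ℝ := fun n => concatPath (W₁ m) (W₂ m) m n ω with hU
  set a : ℕ → Fin p → ℝ := fun n => (∑ i ∈ Finset.range n, Y i ω - R *ᵥ U n) -
    (n : ℝ) • fun l => ∫ ω', Y 0 ω' l ∂μ with ha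
  have hnorm : ∀ n, m ≤ n → ‖a n‖ ≤ 2 * M * (n : ℝ) ^ ξ := by
    intro n hn
    have hUn : U n = W₂ m m ω + W₁ m ((n - m : ℕ) : ℝ≥0) ω := by
      simp only [hU, concatPath]
      rw [min_eq_right (by exact_mod_cast hn), Nat.cast_tsub]
    simp only [ha]
    rw [hUn]
    refine (approxError_add hn _ _ ω).trans ?_
    have h3 : (m : ℝ) ^ ξ ≤ (n : ℝ) ^ ξ :=
      Real.rpow_le_rpow hm0.le (by exact_mod_cast hn) hξ0.le
    have h4 := mul_le_mul_of_nonneg_left h3 hM0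
    have := b1 n hn
    linarith
  refine absurd (show ε ≤ _ from hmem) (not_le.2 (lt_of_le_of_lt (triSup_le fun j k hj hk => ?_) e3))
  refine ENNReal.ofReal_le_ofReal ?_
  have heq : cusum η m (fun n => ∑ i ∈ Finset.range n, Y i ω) j k - R *ᵥ cusum η m U j k
      = cusum η m a j k := by
    simp only [ha]
    rw [cusum_sub, cusum_drift, sub_zero, cusum_sub, cusum_mulVec]
  rw [heq]
  have hmk : (m : ℝ) ≤ k := by exact_mod_cast (hj.trans hk.le)
  have hk0 : (0 : ℝ) < k := hm0.trans_le hmk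
  have hjk : (j : ℝ) ^ ξ ≤ (k : ℝ) ^ ξ :=
    Real.rpow_le_rpow (Nat.cast_nonneg _) (by exact_mod_cast hk.le) hξ0.le
  calc ‖cusum η m a j k‖ ≤ (k : ℝ) ^ (-(1 / 2) : ℝ) * (‖a j‖ + ‖a k‖) :=
        norm_cusum_le' hη hm hj hk
    _ ≤ (k : ℝ) ^ (-(1 / 2) : ℝ) * (4 * M * (k : ℝ) ^ ξ) := by
        refine mul_le_mul_of_nonneg_left ?_ (by positivity)
        have h5 := hnorm j hj
        have h6 := hnorm k (hj.trans hk.le)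
        have h7 := mul_le_mul_of_nonneg_left hjk hM0
        linarith
    _ = 4 * M * (k : ℝ) ^ (-(1 / 2 - ξ)) := by
        rw [show -(1 / 2 - ξ) = -(1 / 2) + ξ by ring, Real.rpow_add hk0]
        ring
    _ ≤ 4 * M * (m : ℝ) ^ (-(1 / 2 - ξ)) := by
        refine mul_le_mul_of_nonneg_left ?_ (by positivity)
        exact Real.rpow_le_rpow_of_nonpos hm0 hmk (by linarith)

end Closeness

/-! ### From the approximation condition to the limit law. -/

section Main

-- The symmetric square root satisfies S^{1/2} S^{-1} S^{1/2} = I.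
open scoped MatrixOrder in
lemma wnorm_inv_matSqrt {p : ℕ} {S : Matrix (Fin p) (Fin p) ℝ} (hS : S.PosDef)
    (y : Fin p → ℝ) : wnorm S⁻¹ (matSqrt S *ᵥ y) = wnorm 1 y := by
  have h0 : 0 ≤ S := hS.posSemidef.nonneg
  have hsq : matSqrt S * matSqrt S = S := CFC.sqrt_mul_sqrt_self S h0
  have hsymm : (matSqrt S)ᵀ = matSqrt S := by
    have : (matSqrt S)ᴴ = matSqrt S :=
      (Matrix.nonneg_iff_posSemidef.1 (CFC.sqrt_nonneg S)).isHermitian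
    rwa [Matrix.conjTranspose_eq_transpose_of_trivial] at this
  have hdet : IsUnit (matSqrt S).det := by
    have h1 : (matSqrt S).det * (matSqrt S).det = S.det := by rw [← Matrix.det_mul, hsq]
    exact isUnit_iff_ne_zero.2 fun h => hS.det_pos.ne' (by rw [← h1, h, zero_mul])
  have hinv : matSqrt S * (S⁻¹ * matSqrt S) = 1 := by
    conv_lhs => rw [← hsq]
    rw [hsq, ← hsq, Matrix.mul_inv_rev, hsq, Matrix.mul_assoc, Matrix.nonsing_inv_mul _ hdet,
      Matrix.mul_one, Matrix.mul_nonsing_inv _ hdet]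
  unfold wnorm
  rw [Matrix.mulVec_mulVec, ← Matrix.vecMul_transpose, hsymm, ← Matrix.dotProduct_mulVec,
    Matrix.mulVec_mulVec, hinv]

lemma exists_norm_mulVec_le {p : ℕ} (A : Matrix (Fin p) (Fin p) ℝ) :
    ∃ C : ℝ≥0, ∀ y, ‖A *ᵥ y‖ ≤ C * ‖y‖ :=
  ⟨‖(Matrix.toLin' A).toContinuousLinearMap‖₊, fun y =>
    (Matrix.toLin' A).toContinuousLinearMap.le_opNorm y⟩

/-- Joint conclusions about the true points: the statistics are stochastically bounded, and, with
the norm of the limiting matrix, their supremum converges in distribution. -/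
lemma approximationCond_consequences {Ω : Type u} [MeasurableSpace Ω] {μ : Measure Ω}
    [IsProbabilityMeasure μ] {p : ℕ} {Y : ℕ → Ω → Fin p → ℝ} {S : Matrix (Fin p) (Fin p) ℝ}
    (hY : ApproximationCond.{u, v} μ Y S) {η : ℝ} (hη : 0 < η) :
    IsBigOP μ (fun m ω => triSup m fun j k =>
      ‖cusum η m (fun n => ∑ i ∈ Finset.range n, Y i ω) j k‖) ∧
    ∀ {Ω₀ : Type w} [MeasurableSpace Ω₀] (Q : Measure Ω₀) [IsProbabilityMeasure Q]
      (W : ℝ≥0 → Ω₀ → Fin p → ℝ), IsStdBrownian W Q →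
      TendstoInDistribution (fun (m : ℕ) ω => triSup m fun j k =>
          wnorm S⁻¹ (cusum η m (fun n => ∑ i ∈ Finset.range n, Y i ω) j k))
        atTop (fun ω => limitSup η fun t => W t ω) (fun _ => μ) Q := by
  obtain ⟨-, -, hpd, Ω', _, μ', _, Y', W₁, W₂, ξ, hlaw, h₁, h₂, hind, hξ0, hξ, hA, hB⟩ := hY
  have hmeas : ∀ n, Measurable fun y : ℕ → Fin p → ℝ => ∑ i ∈ Finset.range n, y i := fun n =>
    Finset.measurable_sum _ fun i _ => measurable_pi_apply i
  have hU := isBigOP_triSup_cusum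
    (fun m i => isPreBrownianReal_concatPath (h₁ m) (h₂ m) (hind m) m i) hη
  obtain ⟨C, hC⟩ := exists_norm_mulVec_le (matSqrt S)
  have hV : IsBigOP μ' fun m ω => triSup m fun j k =>
      ‖matSqrt S *ᵥ cusum η m (fun n => concatPath (W₁ m) (W₂ m) m n ω) j k‖ := by
    refine (hU.const_mul C).mono (Eventually.of_forall fun m => ae_of_all _ fun ω =>
      triSup_le fun j k hj hk => (ENNReal.ofReal_le_ofReal (hC _)).trans ?_)
    rw [ENNReal.ofReal_mul C.coe_nonneg, ENNReal.ofReal_coe_nnreal]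
    exact mul_le_mul_right (le_triSup
      (f := fun j k => ‖cusum η m (fun n => concatPath (W₁ m) (W₂ m) m n ω) j k‖) hj hk) _
  have happ := isLittleOP_cusum_approx h₁ hξ0 hξ hA hB hη.le
  -- The comparison lemma is used with the constant matrix S, so that only the vectors change.
  have hconst : ∀ a b : Fin p, TendstoInMeasure μ' (fun (_ : ℕ) (_ : Ω') => S a b) atTop
      fun _ => S a b := fun a b ε hε => by
    simp [edist_self, not_le.2 hε]
  have hcomp := isLittleOP_wnorm_sub hpd.det_pos.ne' hconst happ hV
  refine ⟨?_, fun {Ω₀} _ Q _ W hW => ?_⟩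
  · have hb : IsBigOP μ' fun m ω => triSup m fun j k =>
        ‖cusum η m (fun n => ∑ i ∈ Finset.range n, Y' i ω) j k‖ := by
      refine (hV.add_isLittleOP happ).mono (Eventually.of_forall fun m => ae_of_all _ fun ω =>
        triSup_le_add fun j k _ _ => ?_)
      exact norm_le_norm_add_norm_sub' _ _
    -- The statistic is a measurable function of the whole series, so the bound passes from the copy
    -- Y' to Y.
    refine hb.of_identDistrib fun m => ?_
    exact hlaw.comp (u := fun y : ℕ → Fin p → ℝ => triSup m fun j k =>
      ‖cusum η m (fun n => ∑ i ∈ Finset.range n, y i) j k‖)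
      (measurable_triSup fun j k => (measurable_cusum hmeas).norm)
  · set G : ℕ → Ω₀ → ℝ≥0∞ := fun m ω => triSup m fun j k =>
      wnorm 1 (cusum η m (fun n => scaledPath W (m : ℝ≥0)⁻¹ n ω) j k) with hG
    have hwn : ∀ (M : Matrix (Fin p) (Fin p) ℝ) (m j k : ℕ), Measurable
        fun y : Fin p → ℕ → ℝ => wnorm M⁻¹ (cusum η m (fun n i => y i n) j k) := fun M m j k =>
      measurable_wnorm_inv (fun _ _ => measurable_const) (measurable_cusum fun n =>
        measurable_pi_lambda _ fun i => (measurable_pi_apply n).comp (measurable_pi_apply i))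
    have hΨ : ∀ m, Measurable fun y : Fin p → ℕ → ℝ => triSup m fun j k =>
        wnorm 1 (cusum η m (fun n i => y i n) j k) := fun m => measurable_triSup fun j k => by
      simpa using hwn 1 m j k
    have hWm : ∀ m : ℕ, AEMeasurable
        (fun ω (i : Fin p) (n : ℕ) => scaledPath W (m : ℝ≥0)⁻¹ n ω i) Q := fun m =>
      aemeasurable_pi_lambda _ fun i => aemeasurable_pi_lambda _ fun n =>
        ((hW.coord i).aemeasurable _).const_mul _
    have hUm : ∀ m : ℕ, AEMeasurable
        (fun ω (i : Fin p) (n : ℕ) => concatPath (W₁ m) (W₂ m) m n ω i) μ' := fun m =>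
      aemeasurable_pi_lambda _ fun i => aemeasurable_pi_lambda _ fun n =>
        (isPreBrownianReal_concatPath (h₁ m) (h₂ m) (hind m) m i).aemeasurable _
    have hGm : ∀ m, AEMeasurable (G m) Q := fun m => (hΨ m).comp_aemeasurable (hWm m)
    have hlim : AEMeasurable (fun ω => limitSup η fun t => W t ω) Q :=
      aemeasurable_of_tendsto_metrizable_ae atTop hGm (hW.ae_tendsto_limitSup η)
    -- One W rescaled by 1/m converges almost surely; only the law of this statistic is then carried
    -- over to the concatenated paths, which change with m.
    have t1 := tendstoInDistribution_of_ae_tendsto hGm hlim (hW.ae_tendsto_limitSup η)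
    have t2 : TendstoInDistribution (fun (m : ℕ) ω => triSup m fun j k =>
        wnorm 1 (cusum η m (fun n => concatPath (W₁ m) (W₂ m) m n ω) j k))
        atTop (fun ω => limitSup η fun t => W t ω) (fun _ => μ') Q := by
      refine t1.of_identDistrib (fun m => (hΨ m).comp_aemeasurable (hUm m)) ?_
      filter_upwards [eventually_ge_atTop 1] with m hm
      exact (identDistrib_scaledPath_concatPath hW (h₁ m) (h₂ m) (hind m) m
        (inv_ne_zero (Nat.cast_ne_zero.2 (by omega)))).comp (hΨ m)
    have hΦ : ∀ m, Measurable fun y : ℕ → Fin p → ℝ => triSup m fun j k =>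
        wnorm S⁻¹ (cusum η m (fun n => ∑ i ∈ Finset.range n, y i) j k) := fun m =>
      measurable_triSup fun j k => measurable_wnorm_inv (fun _ _ => measurable_const)
        (measurable_cusum hmeas)
    have t3 : TendstoInDistribution (fun (m : ℕ) ω => triSup m fun j k =>
        wnorm S⁻¹ (cusum η m (fun n => ∑ i ∈ Finset.range n, Y' i ω) j k))
        atTop (fun ω => limitSup η fun t => W t ω) (fun _ => μ') Q := by
      refine t2.of_isLittleOP (fun m => (hΦ m).comp_aemeasurable hlaw.aemeasurable_fst) hcomp
        (Eventually.of_forall fun m ω => triSup_le_add fun j k _ _ => ?_)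
        (Eventually.of_forall fun m ω => triSup_le_add fun j k _ _ => ?_)
      · rw [← wnorm_inv_matSqrt hpd, abs_sub_comm]
        linarith [le_abs_self (wnorm S⁻¹ (matSqrt S *ᵥ
          cusum η m (fun n => concatPath (W₁ m) (W₂ m) m n ω) j k) -
          wnorm S⁻¹ (cusum η m (fun n => ∑ i ∈ Finset.range n, Y' i ω) j k))]
      · rw [← wnorm_inv_matSqrt hpd]
        linarith [le_abs_self (wnorm S⁻¹ (cusum η m (fun n => ∑ i ∈ Finset.range n, Y' i ω) j k) -
          wnorm S⁻¹ (matSqrt S *ᵥ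
          cusum η m (fun n => concatPath (W₁ m) (W₂ m) m n ω) j k))]
    exact t3.of_identDistrib (fun m => (hΦ m).comp_aemeasurable hlaw.aemeasurable_snd)
      (Eventually.of_forall fun m => hlaw.comp (hΦ m))

end Main

/-- Asymptotic equivalence of the monitoring procedures based on data-driven and on true points.
`X i` is the `(i + 1)`-th observation. -/
theorem proposition6 {Ω : Type u} [MeasurableSpace Ω] (μ : Measure Ω) [IsProbabilityMeasure μ]
    {d p : ℕ} (hd : 1 ≤ d) (hp : 1 ≤ p)
    (X : ℕ → Ω → Fin d → ℝ) (hX : ∀ i, Measurable (X i))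
    (π : Fin p → Fin d → ℝ) (hπ : ∀ i l, π i l ∈ Set.Ioo (0 : ℝ) 1)
    (est est' : (m : ℕ) → (Fin m → Fin p → ℝ) → Matrix (Fin p) (Fin p) ℝ)
    (hest : ∀ m a b, Measurable (fun y => est m y a b))
    (hest' : ∀ m a b, Measurable (fun y => est' m y a b))
    (S : Matrix (Fin p) (Fin p) ℝ)
    (hY : ApproximationCond.{u, v} μ (fun i ω => indVec (truePoints μ (X 0) π) (X i ω)) S)
    (hpts : PointsCond μ X π)
    (hS : IsConsistent μ est X (fun _ _ => truePoints μ (X 0) π) S)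
    (hS' : IsConsistent μ est' X (fun m ω => dataPoints (fun n => X n ω) m π) S)
    (η : ℝ) (hη : 0 < η) :
    IsLittleOP μ (fun m ω => ⨆ (k : ℕ) (_ : m < k), ENNReal.ofReal
      (((m : ℝ) / (k : ℝ)) ^ (3 / 2 + η : ℝ) *
        |detector est' (fun n => X n ω) (dataPoints (fun n => X n ω) m π) m k
          - detector est (fun n => X n ω) (truePoints μ (X 0) π) m k|)) ∧
    ∀ {Ω₀ : Type w} [MeasurableSpace Ω₀] (Q : Measure Ω₀) [IsProbabilityMeasure Q]
      (W : ℝ≥0 → Ω₀ → Fin p → ℝ), IsStdBrownian W Q →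
      (∀ᵐ ω ∂Q, limitSup η (fun t => W t ω) < ∞) ∧
      TendstoInDistribution
        (fun (m : ℕ) ω => ⨆ (k : ℕ) (_ : m < k), ENNReal.ofReal
          (((m : ℝ) / (k : ℝ)) ^ (3 / 2 + η : ℝ) *
            detector est' (fun n => X n ω) (dataPoints (fun n => X n ω) m π) m k))
        atTop (fun ω => limitSup η (fun t => W t ω)) (fun _ => μ) Q := by
  have hdet : S.det ≠ 0 := hY.2.2.1.det_pos.ne'
  obtain ⟨hbig, hdist⟩ := approximationCond_consequences.{u, v, w} hY hη
  have hclose := isLittleOP_cusum_dataPoints hpts hη.le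
  -- At the true points the vectors coincide, so the comparison lemma isolates the effect of the
  -- estimator. Both detectors are then compared with the same statistic, built from the true points
  -- and the norm of S⁻¹.
  have hself : IsLittleOP μ fun m ω => triSup m fun j k =>
      ‖cusum η m (indSum (truePoints μ (X 0) π) fun n => X n ω) j k -
        cusum η m (indSum (truePoints μ (X 0) π) fun n => X n ω) j k‖ := by
    refine isLittleOP_zero.mono (Eventually.of_forall fun m => ae_of_all _ fun ω =>
      triSup_le fun j k _ _ => ?_)
    simp
  have r₁ := isLittleOP_wnorm_sub hdet hS hself hbig
  have r₂ := isLittleOP_wnorm_sub hdet hS' hclose hbig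
  refine ⟨(r₂.add r₁).mono ?_, fun {Ω₀} _ Q _ W hW => ⟨hW.ae_limitSup_lt_top hη, ?_⟩⟩
  · filter_upwards [eventually_ge_atTop 1] with m hm
    refine ae_of_all _ fun ω => iSup₂_le fun k hk => ?_
    refine (abs_weight_mul_detector_sub_le hm hk).trans (triSup_le_add fun j k _ _ => ?_)
    refine (abs_sub_le _ _ _).trans (add_le_add le_rfl (abs_sub_comm _ _).le)
  · refine (hdist Q W hW).of_isLittleOP (fun m => ?_) r₂ ?_ ?_
    · refine Measurable.aemeasurable (.iSup fun k => .iSup fun _ =>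
        (Measurable.const_mul ?_ _).ennreal_ofReal)
      exact measurable_detector hX (fun i => measurable_dataPoints hX hπ m i) hest' m k
    · filter_upwards [eventually_ge_atTop 1] with m hm ω
      rw [iSup_weight_mul_detector hm]
      refine triSup_le_add fun j k _ _ => ?_
      rw [abs_sub_comm]
      exact sub_le_iff_le_add'.1 (le_abs_self _)
    · filter_upwards [eventually_ge_atTop 1] with m hm ω
      rw [iSup_weight_mul_detector hm]
      refine triSup_le_add fun j k _ _ => ?_
      exact sub_le_iff_le_add'.1 (le_abs_self _)
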